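/- Let $\mathbb K$ be an algebraically closed field and let $V$ be a vector space over $\mathbb K$ of finite positive dimension. A tridiagonal pair on $V$ is an ordered pair of linear maps $A,A^*\in\mathrm{End}(V)$ such that: (i) $A$ and $A^*$ are diagonalizable; (ii) there is an ordering $V_0,\dots,V_d$ of the eigenspaces of $A$ with $A^*V_i\subseteq V_{i-1}+V_i+V_{i+1}$ for $0\le i\le d$, where $V_{-1}=V_{d+1}=0$; (iii) there is an ordering $V_0^*,\dots,V_\delta^*$ of the eigenspaces of $A^*$ with $AV_i^*\subseteq V^*_{i-1}+V^*_i+V^*_{i+1}$ for $0\le i\le\delta$, where $V^*_{-1}=V^*_{\delta+1}=0$; (iv) no subspace $W$ of $V$ satisfies $AW\subseteq W$, $A^*W\subseteq W$, $W\ne0$, $W\neq V$. Orderings as in (ii), (iii) are called standard. Let $\Phi=(A;\{E_i\}_{i=0}^d;A^*;\{E_i^*\}_{i=0}^d)$ be a tridiagonal system on $V$ with $d\ge1$; that is, $A,A^*$ is a tridiagonal pair on $V$, and $\{E_i\}_{i=0}^d$ (resp. $\{E_i^*\}_{i=0}^d$) are the projections onto the eigenspaces of $A$ (resp. $A^*$)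 taken in a standard order (so that $E_i$ is the identity on the $i$-th eigenspace and zero on the others). Let $\theta_i$ (resp. $\theta_i^*$) be the eigenvalue of $A$ (resp. $A^*$) on $E_iV$ (resp. $E_i^*V$). Assume that $\Phi$ has $q$-Racah type: $q,a,b\in\mathbb K$ are nonzero, $q^4\ne1$, and $$\theta_i=aq^{d-2i}+a^{-1}q^{2i-d},\qquad \theta_i^*=bq^{d-2i}+b^{-1}q^{2i-d}\qquad(0\le i\le d).$$ For $0\le i\le d$ put $$U_i=(E_0^*V+\cdots+E_i^*V)\cap(E_iV+\cdots+E_dV),\qquad U_i^\Downarrow=(E_0^*V+\cdots+E_i^*V)\cap(E_0V+\cdots+E_{d-i}V),$$ and for $0\le i\le d/2$ put $K_i=(E_0^*V+\cdots+E_i^*V)\cap(E_iV+\cdots+E_{d-i}V)$. Then the following hold. (1) There is a unique $K\in\mathrm{End}(V)$ such that $U_i$ is the eigenspace of $K$ with eigenvalue $q^{d-2i}$ for $0\le i\le d$, and a unique $B\in\mathrm{End}(V)$ such that $U_i^\Downarrow$ is the eigenspace of $B$ with eigenvalue $q^{d-2i}$ for $0\le i\le d$. Both $K$ and $B$ are invertible.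 Put $R=A-aK-a^{-1}K^{-1}$ and $R^\Downarrow=A-a^{-1}B-aB^{-1}$. (2) There is a unique $\psi\in\mathrm{End}(V)$ such that $\psi R-R\psi=(q-q^{-1})(K-K^{-1})$ and $\psi K_i=0$ for $0\le i\le d/2$. (3) Let $U_q(\mathfrak{sl}_2)$ be the unital associative $\mathbb K$-algebra with generators $e,f,k,k^{-1}$ and relations $$kk^{-1}=k^{-1}k=1,\quad kek^{-1}=q^2e,\quad kfk^{-1}=q^{-2}f,\quad ef-fe=\frac{k-k^{-1}}{q-q^{-1}}.$$ There exists a $U_q(\mathfrak{sl}_2)$-module structure on the $\mathbb K$-vector space $V$ for which $e$ acts as $(q-q^{-1})^{-1}\psi$, $f$ acts as $(q-q^{-1})^{-1}R^\Downarrow$, $k$ acts as $B$, and $k^{-1}$ acts as $B^{-1}$. -/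

import Mathlib

/-! ### Tridiagonal pairs -/

/-- `W` is an eigenspace of `A`: it is nonzero, and it consists of all `v` with `A v = θ v`
for some scalar `θ`. -/
def IsEigenspaceOf {𝕜 V : Type*} [Field 𝕜] [AddCommGroup V] [Module 𝕜 V]
    (A : Module.End 𝕜 V) (W : Submodule 𝕜 V) : Prop :=
  W ≠ ⊥ ∧ ∃ θ : 𝕜, W = A.eigenspace θ

/-- `A` is diagonalizable: the space is spanned by the eigenspaces of `A`. -/
def IsDiagonalizableEnd {𝕜 V : Type*} [Field 𝕜] [AddCommGroup V] [Module 𝕜 V]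
    (A : Module.End 𝕜 V) : Prop :=
  sSup {W : Submodule 𝕜 V | IsEigenspaceOf A W} = ⊤

/-- `W 0, …, W d` is an ordering of the eigenspaces of `A`: a list of all the eigenspaces
without repetition. -/
def IsEigenspaceOrdering {𝕜 V : Type*} [Field 𝕜] [AddCommGroup V] [Module 𝕜 V] {d : ℕ}
    (A : Module.End 𝕜 V) (W : Fin (d + 1) → Submodule 𝕜 V) : Prop :=
  Function.Injective W ∧ Set.range W = {X : Submodule 𝕜 V | IsEigenspaceOf A X}

/-- `C W_i ⊆ W_{i-1} + W_i + W_{i+1}` for `0 ≤ i ≤ d`, where `W_{-1} = W_{d+1} = 0`. -/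
def ActsTridiagonally {𝕜 V : Type*} [Field 𝕜] [AddCommGroup V] [Module 𝕜 V] {d : ℕ}
    (C : Module.End 𝕜 V) (W : Fin (d + 1) → Submodule 𝕜 V) : Prop :=
  ∀ i : Fin (d + 1), (W i).map C ≤
    ⨆ (j : Fin (d + 1)) (_ : (j : ℕ) ≤ (i : ℕ) + 1 ∧ (i : ℕ) ≤ (j : ℕ) + 1), W j

/-- The ordered pair `A`, `Astar` is a tridiagonal pair on `V`. (`Astar` is an arbitrary linear map,
not an adjoint of `A`.) -/
structure IsTDPair {𝕜 V : Type*} [Field 𝕜] [AddCommGroup V] [Module 𝕜 V]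
    (A Astar : Module.End 𝕜 V) : Prop where
  diag : IsDiagonalizableEnd A
  diag_star : IsDiagonalizableEnd Astar
  exists_ordering : ∃ (d : ℕ) (W : Fin (d + 1) → Submodule 𝕜 V),
    IsEigenspaceOrdering A W ∧ ActsTridiagonally Astar W
  exists_ordering_star : ∃ (d : ℕ) (W : Fin (d + 1) → Submodule 𝕜 V),
    IsEigenspaceOrdering Astar W ∧ ActsTridiagonally A W
  irreducible : ¬ ∃ W : Submodule 𝕜 V, W.map A ≤ W ∧ W.map Astar ≤ W ∧ W ≠ ⊥ ∧ W ≠ ⊤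

/-! ### Tridiagonal systems -/

/-- `E 0, …, E d` is an ordering of the primitive idempotents of `A`: the images `E_i V` are an
ordering of the eigenspaces of `A`, and `E_i` is the identity on `E_i V` and zero on `E_j V` for
`j ≠ i`. -/
structure IsPrimitiveIdempotentOrdering {𝕜 V : Type*} [Field 𝕜] [AddCommGroup V] [Module 𝕜 V]
    {d : ℕ} (A : Module.End 𝕜 V) (E : Fin (d + 1) → Module.End 𝕜 V) : Prop where
  ordering : IsEigenspaceOrdering A fun i => LinearMap.range (E i)
  apply_self : ∀ i, ∀ v ∈ LinearMap.range (E i), E i v = v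
  apply_of_ne : ∀ i j, j ≠ i → ∀ v ∈ LinearMap.range (E j), E i v = 0

/-- A tridiagonal system `(A; {E_i}; A^*; {E_i^*})` of diameter `d` on `V`: a tridiagonal pair
together with standard orderings of the primitive idempotents of `A` and of `A^*`. -/
structure TDSystem (𝕜 V : Type*) [Field 𝕜] [AddCommGroup V] [Module 𝕜 V] (d : ℕ) where
  /-- the map `A` -/
  A : Module.End 𝕜 V
  /-- the map `A^*` -/
  Astar : Module.End 𝕜 V
  /-- the primitive idempotents of `A` -/
  E : Fin (d + 1) → Module.End 𝕜 V
  /-- the primitive idempotents of `A^*` -/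
  Estar : Fin (d + 1) → Module.End 𝕜 V
  isTDPair : IsTDPair A Astar
  primitive : IsPrimitiveIdempotentOrdering A E
  standard : ActsTridiagonally Astar fun i => LinearMap.range (E i)
  primitive_star : IsPrimitiveIdempotentOrdering Astar Estar
  standard_star : ActsTridiagonally A fun i => LinearMap.range (Estar i)

namespace TDSystem

/-- The second inversion `Φ^⇓ = (A; {E_{d-i}}; A^*; {E_i^*})` of `Φ`. -/
def secondInversion {𝕜 V : Type*} [Field 𝕜] [AddCommGroup V] [Module 𝕜 V] {d : ℕ}
    (Φ : TDSystem 𝕜 V d) : TDSystem 𝕜 V d where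
  A := Φ.A
  Astar := Φ.Astar
  E := fun i => Φ.E (Fin.rev i)
  Estar := Φ.Estar
  isTDPair := Φ.isTDPair
  primitive :=
    { ordering := by
        refine ⟨fun i j h => Fin.rev_injective (Φ.primitive.ordering.1 h), ?_⟩
        rw [← Φ.primitive.ordering.2]
        exact Fin.rev_surjective.range_comp fun i => LinearMap.range (Φ.E i)
      apply_self := fun i => Φ.primitive.apply_self (Fin.rev i)
      apply_of_ne := fun i j h =>
        Φ.primitive.apply_of_ne (Fin.rev i) (Fin.rev j) fun h' => h (Fin.rev_injective h') }
  standard := by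
    intro i
    refine (Φ.standard (Fin.rev i)).trans (iSup₂_le fun j hj => ?_)
    have hj' : ((Fin.rev j : Fin (d + 1)) : ℕ) ≤ (i : ℕ) + 1 ∧
        (i : ℕ) ≤ ((Fin.rev j : Fin (d + 1)) : ℕ) + 1 := by
      have h1 := i.isLt
      have h2 := j.isLt
      simp only [Fin.val_rev] at hj ⊢
      omega
    refine le_trans ?_ (le_iSup₂ (f := fun (k : Fin (d + 1))
      (_ : (k : ℕ) ≤ (i : ℕ) + 1 ∧ (i : ℕ) ≤ (k : ℕ) + 1) =>
        LinearMap.range (Φ.E (Fin.rev k))) (Fin.rev j) hj')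
    simp only [Fin.rev_rev]
    exact le_refl _
  primitive_star := Φ.primitive_star
  standard_star := Φ.standard_star

/-- `Φ` has `q`-Racah type with parameters `q`, `a`, `b`: these are nonzero, `q ^ 4 ≠ 1`, and the
eigenvalues of `A`, `A^*` associated with `E_i`, `E_i^*` are
`θ_i = a q^{d-2i} + a⁻¹ q^{2i-d}` and `θ_i^* = b q^{d-2i} + b⁻¹ q^{2i-d}`. -/
structure IsQRacah {𝕜 V : Type*} [Field 𝕜] [AddCommGroup V] [Module 𝕜 V] {d : ℕ}
    (Φ : TDSystem 𝕜 V d) (q a b : 𝕜) : Prop where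
  q_ne_zero : q ≠ 0
  a_ne_zero : a ≠ 0
  b_ne_zero : b ≠ 0
  q_pow_four_ne_one : q ^ 4 ≠ 1
  eigenvalue : ∀ i : Fin (d + 1), LinearMap.range (Φ.E i) =
    Φ.A.eigenspace (a * q ^ ((d : ℤ) - 2 * ((i : ℕ) : ℤ)) + a⁻¹ * q ^ (2 * ((i : ℕ) : ℤ) - (d : ℤ)))
  eigenvalue_star : ∀ i : Fin (d + 1), LinearMap.range (Φ.Estar i) =
    Φ.Astar.eigenspace
      (b * q ^ ((d : ℤ) - 2 * ((i : ℕ) : ℤ)) + b⁻¹ * q ^ (2 * ((i : ℕ) : ℤ) - (d : ℤ)))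

/-- The component `U_i = (E_0^*V + ⋯ + E_i^*V) ∩ (E_iV + ⋯ + E_dV)` of the first split
decomposition. For `Φ.secondInversion` this is the component
`U_i^⇓ = (E_0^*V + ⋯ + E_i^*V) ∩ (E_0V + ⋯ + E_{d-i}V)` of the second split decomposition. -/
def splitComponent {𝕜 V : Type*} [Field 𝕜] [AddCommGroup V] [Module 𝕜 V] {d : ℕ}
    (Φ : TDSystem 𝕜 V d) (i : Fin (d + 1)) : Submodule 𝕜 V :=
  (⨆ (j : Fin (d + 1)) (_ : j ≤ i), LinearMap.range (Φ.Estar j)) ⊓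
    ⨆ (j : Fin (d + 1)) (_ : i ≤ j), LinearMap.range (Φ.E j)

/-- The subspace `K_i = (E_0^*V + ⋯ + E_i^*V) ∩ (E_iV + ⋯ + E_{d-i}V)`, used for `i ≤ d/2`. -/
def lowComponent {𝕜 V : Type*} [Field 𝕜] [AddCommGroup V] [Module 𝕜 V] {d : ℕ}
    (Φ : TDSystem 𝕜 V d) (i : Fin (d + 1)) : Submodule 𝕜 V :=
  (⨆ (j : Fin (d + 1)) (_ : j ≤ i), LinearMap.range (Φ.Estar j)) ⊓
    ⨆ (j : Fin (d + 1)) (_ : (i : ℕ) ≤ (j : ℕ) ∧ (j : ℕ) + (i : ℕ) ≤ d), LinearMap.range (Φ.E j)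

/-- The defining property of the map `K` of `Φ`: for `0 ≤ i ≤ d`, `U_i` is the eigenspace of `K`
with eigenvalue `q^{d-2i}`. For `Φ.secondInversion` this is the defining property of
`B = K^⇓`. -/
def IsSplitEigenmap {𝕜 V : Type*} [Field 𝕜] [AddCommGroup V] [Module 𝕜 V] {d : ℕ}
    (Φ : TDSystem 𝕜 V d) (q : 𝕜) (K : Module.End 𝕜 V) : Prop :=
  ∀ i : Fin (d + 1), K.eigenspace (q ^ ((d : ℤ) - 2 * ((i : ℕ) : ℤ))) = Φ.splitComponent i

/-- The map `A - a K - a⁻¹ K⁻¹`. With the map `K` of `Φ` it is the raising map `R`. As `Φ^⇓` has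
eigenvalue parameter `a⁻¹` in place of `a`, the raising map `R^⇓ = A - a⁻¹ B - a B⁻¹` of `Φ^⇓` is
`Φ.secondInversion.raisingMap a⁻¹ B`. -/
def raisingMap {𝕜 V : Type*} [Field 𝕜] [AddCommGroup V] [Module 𝕜 V] {d : ℕ}
    (Φ : TDSystem 𝕜 V d) (a : 𝕜) (K : (Module.End 𝕜 V)ˣ) : Module.End 𝕜 V :=
  Φ.A - a • (K : Module.End 𝕜 V) - a⁻¹ • ((K⁻¹ : (Module.End 𝕜 V)ˣ) : Module.End 𝕜 V)

/-- The defining property of the double lowering operator `ψ` of `Φ`, where `K` is the map `K` of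
`Φ`: `ψ R - R ψ = (q - q⁻¹)(K - K⁻¹)`, and `ψ K_i = 0` for `0 ≤ i ≤ d/2`. -/
structure IsDoubleLowering {𝕜 V : Type*} [Field 𝕜] [AddCommGroup V] [Module 𝕜 V] {d : ℕ}
    (Φ : TDSystem 𝕜 V d) (q a : 𝕜) (K : (Module.End 𝕜 V)ˣ) (ψ : Module.End 𝕜 V) : Prop where
  commutator : ψ * Φ.raisingMap a K - Φ.raisingMap a K * ψ =
    (q - q⁻¹) • ((K : Module.End 𝕜 V) - ((K⁻¹ : (Module.End 𝕜 V)ˣ) : Module.End 𝕜 V))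
  apply_eq_zero : ∀ i : Fin (d + 1), 2 * (i : ℕ) ≤ d → ∀ v ∈ Φ.lowComponent i, ψ v = 0

end TDSystem

/-! ### The algebra `U_q(sl_2)` -/

/-- Symbols for the Chevalley generators `e`, `f`, `k`, `k⁻¹`. -/
inductive ChevalleyGen : Type
  | e | f | k | kinv

/-- The defining relations of `U_q(sl_2)` in the free algebra on `e`, `f`, `k`, `k⁻¹`. -/
inductive UqRel (𝕜 : Type*) [Field 𝕜] (q : 𝕜) :
    FreeAlgebra 𝕜 ChevalleyGen → FreeAlgebra 𝕜 ChevalleyGen → Prop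
  | k_mul_kinv : UqRel 𝕜 q
      (FreeAlgebra.ι 𝕜 ChevalleyGen.k * FreeAlgebra.ι 𝕜 ChevalleyGen.kinv) 1
  | kinv_mul_k : UqRel 𝕜 q
      (FreeAlgebra.ι 𝕜 ChevalleyGen.kinv * FreeAlgebra.ι 𝕜 ChevalleyGen.k) 1
  | k_e : UqRel 𝕜 q
      (FreeAlgebra.ι 𝕜 ChevalleyGen.k * FreeAlgebra.ι 𝕜 ChevalleyGen.e *
        FreeAlgebra.ι 𝕜 ChevalleyGen.kinv)
      (q ^ 2 • FreeAlgebra.ι 𝕜 ChevalleyGen.e)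
  | k_f : UqRel 𝕜 q
      (FreeAlgebra.ι 𝕜 ChevalleyGen.k * FreeAlgebra.ι 𝕜 ChevalleyGen.f *
        FreeAlgebra.ι 𝕜 ChevalleyGen.kinv)
      ((q ^ 2)⁻¹ • FreeAlgebra.ι 𝕜 ChevalleyGen.f)
  | e_f : UqRel 𝕜 q
      (FreeAlgebra.ι 𝕜 ChevalleyGen.e * FreeAlgebra.ι 𝕜 ChevalleyGen.f -
        FreeAlgebra.ι 𝕜 ChevalleyGen.f * FreeAlgebra.ι 𝕜 ChevalleyGen.e)
      ((q - q⁻¹)⁻¹ • (FreeAlgebra.ι 𝕜 ChevalleyGen.k - FreeAlgebra.ι 𝕜 ChevalleyGen.kinv))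

/-- The `𝕜`-algebra `U_q(sl_2)`, by generators and relations. -/
abbrev Uqsl2 (𝕜 : Type*) [Field 𝕜] (q : 𝕜) : Type _ := RingQuot (UqRel 𝕜 q)

/-- The Chevalley generators as elements of `U_q(sl_2)`. -/
def Uqsl2.gen {𝕜 : Type*} [Field 𝕜] (q : 𝕜) (g : ChevalleyGen) : Uqsl2 𝕜 q :=
  RingQuot.mkAlgHom 𝕜 (UqRel 𝕜 q) (FreeAlgebra.ι 𝕜 g)

/-! The module structure follows once `ψ`, defined from `Φ`, is seen to be the double lowering
operator of `Φ^⇓` as well: relative to the grading `U_n^⇓` the map `B` is scalar on each degree,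
`R^⇓` raises by one, `ψ` lowers by one, and the commutator of `ψ` with `R^⇓` is the one required.

For one system, irreducibility makes `V` the direct sum of the `U_n`, and on `U_n` the raising map
`R` is `A - θ_n`. Hence powers of `R` are products of factors `A - θ_n`, whose kernels are sums of
eigenspaces of `A`. Comparing with the split decomposition of `Φ^⇓` shows that `R ^ (d - 2 i)` is a
bijection from `U_i` onto `U_{d-i}` (`isLefschetz`), and that the primitive vectors of degree `i`
are exactly `K_i` (`primitivePart_eq`). As in `sl_2` theory, `V` is the direct sum of the strings `R
^ j K_i`, and `ψ` is determined on each string by the commutator relation and `ψ K_i = 0`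
(`existsUnique_isLowering`).

To compare `Φ` with `Φ^⇓`, the map `R` is eliminated in favour of `A`, which they share. On the
`A`-module generated by a primitive vector, `A` and `ψ` satisfy a cubic relation involving `a` only
through `a + a⁻¹` (`CubicRelation`). This is a two-step recurrence for `ψ (A ^ n p)` with initial
values free of `a`. Since `K_i` is common to both systems and `Φ^⇓` has parameter `a⁻¹`, the two
operators agree (`IsLowering.eq_of_inv`). -/

namespace LinearMap

/-! ### Direct sums: prescribing maps and proving independence -/

variable {𝕜 V : Type*} [Field 𝕜] [AddCommGroup V] [Module 𝕜 V]

/-- A linear map may be prescribed on the summands of a direct sum decomposition. -/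
theorem exists_apply_eq_of_bijective_lsum {ι : Type*} [Fintype ι] [DecidableEq ι]
    {M : ι → Type*} [∀ i, AddCommGroup (M i)] [∀ i, Module 𝕜 (M i)] {f : ∀ i, M i →ₗ[𝕜] V}
    (hf : Function.Bijective (LinearMap.lsum 𝕜 M 𝕜 f)) (g : ∀ i, M i →ₗ[𝕜] V) :
    ∃ φ : Module.End 𝕜 V, ∀ i (x : M i), φ (f i x) = g i x := by
  refine ⟨LinearMap.lsum 𝕜 M 𝕜 g ∘ₗ
    ((LinearEquiv.ofBijective _ hf).symm : V →ₗ[𝕜] _), fun i x => ?_⟩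
  have h : (LinearEquiv.ofBijective _ hf).symm (f i x) = Pi.single i x := by
    rw [LinearEquiv.symm_apply_eq, LinearEquiv.ofBijective_apply, LinearMap.lsum_piSingle]
  simp only [LinearMap.comp_apply, LinearEquiv.coe_coe]
  rw [h, LinearMap.lsum_piSingle]

end LinearMap

/-- An increasing family `F` and submodules `U n ≤ F (n + 1)` with `F n ∩ U n = 0` give an
independent family. -/
theorem Submodule.iSupIndep_of_disjoint_flag {𝕜 V : Type*} [Field 𝕜] [AddCommGroup V] [Module 𝕜 V]
    {F U : ℕ → Submodule 𝕜 V} (hF : Monotone F) (hU : ∀ n, U n ≤ F (n + 1))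
    (hd : ∀ n, Disjoint (F n) (U n)) : iSupIndep U := by
  classical
  rw [iSupIndep_iff_finsetSum_eq_zero_imp_eq_zero]
  intro s v
  -- Every term other than the one of largest index `m` lies in `F m`, which meets `U m` trivially.
  induction s using Finset.induction_on_max with
  | empty => simp
  | insert m s hs ih =>
    intro hmem hv
    rw [Finset.sum_insert (fun h => (hs m h).false)] at hv
    have hmem' : ∑ i ∈ s, v i ∈ F m := Submodule.sum_mem _ fun i hi =>
      hF (Nat.succ_le_of_lt (hs i hi)) (hU i (hmem i (Finset.mem_insert_of_mem hi)))
    have h0 : v m = 0 := by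
      refine Submodule.disjoint_def.1 (hd m) _ ?_ (hmem m (Finset.mem_insert_self _ _))
      rw [eq_neg_of_add_eq_zero_left hv]
      exact Submodule.neg_mem _ hmem'
    rw [h0, zero_add] at hv
    intro i hi
    rcases Finset.mem_insert.1 hi with rfl | hi
    · exact h0
    · exact ih (fun i hi => hmem i (Finset.mem_insert_of_mem hi)) hv i hi

/-! ### Lefschetz gradings and their primitive decomposition -/

namespace Lefschetz

variable {𝕜 V : Type*} [Field 𝕜] [AddCommGroup V] [Module 𝕜 V]

/-- A grading `U 0, …, U d` of `V` with a raising map `R` for which `R ^ (d - 2 i)` is a bijection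
from `U i` onto `U (d - i)`. -/
structure IsLefschetz (d : ℕ) (U : ℕ → Submodule 𝕜 V) (R : Module.End 𝕜 V) : Prop where
  indep : iSupIndep U
  iSup_eq_top : ⨆ n, U n = ⊤
  eq_bot : ∀ n, d < n → U n = ⊥
  raise : ∀ n, ∀ x ∈ U n, R x ∈ U (n + 1)
  injective : ∀ i, 2 * i ≤ d → ∀ x ∈ U i, (R ^ (d - 2 * i)) x = 0 → x = 0
  surjective : ∀ i, 2 * i ≤ d → ∀ y ∈ U (d - i), ∃ x ∈ U i, (R ^ (d - 2 * i)) x = y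

/-- The primitive part of degree `i`. -/
def primitivePart (d : ℕ) (U : ℕ → Submodule 𝕜 V) (R : Module.End 𝕜 V) (i : ℕ) :
    Submodule 𝕜 V :=
  U i ⊓ LinearMap.ker (R ^ (d + 1 - 2 * i))

variable {d : ℕ} {U : ℕ → Submodule 𝕜 V} {R : Module.End 𝕜 V}

theorem IsLefschetz.pow_mem (h : IsLefschetz d U R) (j : ℕ) {n : ℕ} {x : V} (hx : x ∈ U n) :
    (R ^ j) x ∈ U (n + j) := by
  induction j with
  | zero => simpa using hx
  | succ j ih =>
    rw [pow_succ', Module.End.mul_apply, ← add_assoc]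
    exact h.raise _ _ ih

theorem IsLefschetz.pow_eq_zero {i j : ℕ} {p : V}
    (hp : p ∈ primitivePart d U R i) (hj : d + 1 - 2 * i ≤ j) : (R ^ j) p = 0 := by
  obtain ⟨k, rfl⟩ := Nat.exists_eq_add_of_le' hj
  rw [pow_add, Module.End.mul_apply, LinearMap.mem_ker.1 hp.2, map_zero]

/-- `V` is spanned by the vectors `R ^ j p` with `p` primitive. -/
theorem IsLefschetz.eq_top (h : IsLefschetz d U R) {N : Submodule 𝕜 V}
    (hN : ∀ i, 2 * i ≤ d → ∀ p ∈ primitivePart d U R i, ∀ j, j + 2 * i ≤ d → (R ^ j) p ∈ N) :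
    N = ⊤ := by
  have hN' : ∀ i, 2 * i ≤ d → ∀ p ∈ primitivePart d U R i, ∀ j, (R ^ j) p ∈ N := by
    intro i hi p hp j
    by_cases hj : j + 2 * i ≤ d
    · exact hN i hi p hp j hj
    · rw [IsLefschetz.pow_eq_zero hp (by omega)]
      exact zero_mem _
  have low : ∀ m, 2 * m ≤ d → ∀ x ∈ U m, ∀ j, (R ^ j) x ∈ N := by
    intro m
    induction m with
    | zero =>
      intro hm x hx
      refine hN' 0 hm x ⟨hx, ?_⟩
      have := h.pow_mem (d + 1 - 2 * 0) hx
      rw [h.eq_bot _ (by omega)] at this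
      exact (Submodule.mem_bot 𝕜).1 this
    | succ m ih =>
      intro hm x hx j
      have h1 := h.pow_mem (d + 1 - 2 * (m + 1)) hx
      -- `R ^ (d - 2 m - 1)` sends `x` into `U (d - m)`, which is also reached from `U m`; the
      -- difference `x - R y` is then primitive.
      obtain ⟨y, hy, hxy⟩ := h.surjective m (by omega) ((R ^ (d + 1 - 2 * (m + 1))) x) (by
        convert h1 using 2; omega)
      have hp : x - R y ∈ primitivePart d U R (m + 1) := by
        refine ⟨Submodule.sub_mem _ hx (h.raise _ _ hy), ?_⟩
        rw [SetLike.mem_coe, LinearMap.mem_ker, map_sub, ← hxy, ← Module.End.mul_apply, ← pow_succ,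
          show d + 1 - 2 * (m + 1) + 1 = d - 2 * m by omega, sub_self]
      have h2 := Submodule.add_mem _ (hN' (m + 1) hm _ hp j) (ih (by omega) y hy (j + 1))
      rwa [map_sub, pow_succ, Module.End.mul_apply, sub_add_cancel] at h2
  rw [eq_top_iff, ← h.iSup_eq_top]
  refine iSup_le fun m x hx => ?_
  rcases le_or_gt (2 * m) d with hm | hm
  · exact low m hm x hx 0
  · rcases le_or_gt m d with hm' | hm'
    · obtain ⟨y, hy, rfl⟩ := h.surjective (d - m) (by omega) x (by
        rwa [Nat.sub_sub_self hm'])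
      exact low (d - m) (by omega) y hy _
    · rw [h.eq_bot m hm', Submodule.mem_bot] at hx
      rw [hx]
      exact zero_mem _

/-- The sum of the spaces `R ^ j P_i` with `2 i + j ≤ d` is direct. -/
theorem IsLefschetz.eq_zero_of_sum_eq_zero (h : IsLefschetz d U R) {S : Finset (ℕ × ℕ)}
    (hS : ∀ p ∈ S, 2 * p.1 + p.2 ≤ d) {w : ℕ × ℕ → V}
    (hw : ∀ p ∈ S, w p ∈ primitivePart d U R p.1)
    (hsum : ∑ p ∈ S, (R ^ p.2) (w p) = 0) : ∀ p ∈ S, w p = 0 := by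
  classical
  have hgrade : ∀ m, ∑ p ∈ S with p.1 + p.2 = m, (R ^ p.2) (w p) = 0 := by
    have hmem : ∀ m, ∑ p ∈ S with p.1 + p.2 = m, (R ^ p.2) (w p) ∈ U m := by
      refine fun m => Submodule.sum_mem _ fun p hp => ?_
      rw [Finset.mem_filter] at hp
      rw [← hp.2]
      exact h.pow_mem _ (hw p hp.1).1
    have hall := (iSupIndep_iff_finsetSum_eq_zero_imp_eq_zero U).1 h.indep
      (S.image fun p => p.1 + p.2) _ (fun m _ => hmem m) (by
        rw [← hsum]
        exact Finset.sum_fiberwise_of_maps_to (fun p hp => Finset.mem_image_of_mem _ hp) _)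
    intro m
    by_cases hm : m ∈ S.image fun p => p.1 + p.2
    · exact hall m hm
    · refine Finset.sum_eq_zero fun p hp => ?_
      rw [Finset.mem_filter] at hp
      exact absurd (Finset.mem_image.2 ⟨p, hp.1, hp.2⟩) hm
  suffices H : ∀ i j, (i, j) ∈ S → w (i, j) = 0 from fun p hp => H p.1 p.2 hp
  intro i
  induction i using Nat.strong_induction_on with
  | _ i ih =>
    intro j hij
    have hd := hS _ hij
    simp only at hd
    -- In degree `i + j` this power isolates the `i`-th term: terms with smaller `i'` vanish by
    -- induction, and for `i' > i` the total exponent `d - i - i'` is at least `d + 1 - 2 i'`, which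
    -- kills the primitive vector.
    have h1 := congrArg (R ^ (d - 2 * i - j)) (hgrade (i + j))
    rw [map_zero, map_sum, Finset.sum_eq_single (i, j)] at h1
    · rw [← Module.End.mul_apply, ← pow_add,
        show d - 2 * i - j + (i, j).2 = d - 2 * i by simp only; omega] at h1
      exact h.injective i (by omega) _ (hw _ hij).1 h1
    · rintro ⟨i', j'⟩ hp hne
      rw [Finset.mem_filter] at hp
      obtain ⟨hp, hij'⟩ := hp
      simp only at hij'
      rcases lt_trichotomy i' i with hlt | rfl | hgt
      · rw [ih i' hlt j' hp, map_zero, map_zero]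
      · exact absurd (by simp; omega) hne
      · rw [← Module.End.mul_apply, ← pow_add]
        exact IsLefschetz.pow_eq_zero (hw _ hp) (by simp only; omega)
    · intro hn
      exact absurd (Finset.mem_filter.2 ⟨hij, (rfl : i + j = i + j)⟩) hn

/-- A linear map may be prescribed on the vectors `R ^ j p`, linearly in the primitive vector `p`. -/
theorem IsLefschetz.exists_apply_pow (h : IsLefschetz d U R) (g : ℕ → ℕ → Module.End 𝕜 V) :
    ∃ φ : Module.End 𝕜 V, ∀ i j, 2 * i + j ≤ d → ∀ p ∈ primitivePart d U R i,
      φ ((R ^ j) p) = g i j p := by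
  classical
  let S : Finset (ℕ × ℕ) :=
    (Finset.range (d + 1) ×ˢ Finset.range (d + 1)).filter fun p => 2 * p.1 + p.2 ≤ d
  have hS : ∀ p, p ∈ S ↔ 2 * p.1 + p.2 ≤ d := by
    intro p
    simp only [S, Finset.mem_filter, Finset.mem_product, Finset.mem_range]
    omega
  let f : ∀ p : S, primitivePart d U R p.1.1 →ₗ[𝕜] V :=
    fun p => (R ^ p.1.2) ∘ₗ (primitivePart d U R p.1.1).subtype
  have hf : Function.Bijective (LinearMap.lsum 𝕜 (fun p : S => primitivePart d U R p.1.1) 𝕜 f) := by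
    constructor
    · rw [← LinearMap.ker_eq_bot, LinearMap.ker_eq_bot']
      intro v hv
      let w : ℕ × ℕ → V := fun p => if hp : p ∈ S then v ⟨p, hp⟩ else 0
      have hw : ∀ p : S, w p.1 = v p := fun p => dif_pos p.2
      have hsum : ∑ p ∈ S, (R ^ p.2) (w p) = 0 := by
        rw [← hv, LinearMap.lsum_apply, LinearMap.sum_apply, ← Finset.sum_coe_sort S]
        exact Finset.sum_congr rfl fun p _ => by simp [f, hw]
      have h0 := h.eq_zero_of_sum_eq_zero (fun p hp => (hS p).1 hp)
        (fun p hp => (hw ⟨p, hp⟩) ▸ (v ⟨p, hp⟩).2) hsum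
      funext p
      exact Subtype.ext ((hw p).symm.trans (h0 p.1 p.2))
    · rw [← LinearMap.range_eq_top]
      refine h.eq_top fun i _ p hp j hj => ?_
      refine ⟨Pi.single (⟨(i, j), (hS _).2 (by simp only; omega)⟩ : S) ⟨p, hp⟩, ?_⟩
      rw [LinearMap.lsum_piSingle]
      rfl
  obtain ⟨φ, hφ⟩ := LinearMap.exists_apply_eq_of_bijective_lsum hf
    fun p => g p.1.1 p.1.2 ∘ₗ (primitivePart d U R p.1.1).subtype
  exact ⟨φ, fun i j hij p hp => hφ ⟨(i, j), (hS _).2 hij⟩ ⟨p, hp⟩⟩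

/-! ### The double lowering operator on a Lefschetz grading -/

/-- `K` acts on `U n` as `q ^ (d - 2 n)`. -/
def ActsAsPow (d : ℕ) (U : ℕ → Submodule 𝕜 V) (q : 𝕜) (K : Module.End 𝕜 V) : Prop :=
  ∀ n : ℕ, ∀ x ∈ U n, K x = q ^ ((d : ℤ) - 2 * n) • x

/-- The scalar relating `ψ (R ^ j p)` and `R ^ (j - 1) p`, for `p` primitive of degree `i`. -/
def lowerCoeff (q : 𝕜) (d i j : ℕ) : 𝕜 :=
  (q ^ (j : ℤ) - q ^ (-(j : ℤ))) *
    (q ^ ((d : ℤ) - 2 * i - j + 1) - q ^ (-((d : ℤ) - 2 * i - j + 1)))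

theorem lowerCoeff_zero (q : 𝕜) (d i : ℕ) : lowerCoeff q d i 0 = 0 := by
  simp [lowerCoeff]

/-- Here `j = d + 1 - 2 i` is the exponent at which `R ^ j p` vanishes, so the formula for `ψ` is
consistent at the top of a string. -/
theorem lowerCoeff_eq_zero (q : 𝕜) {d i j : ℕ} (h : 2 * i + j = d + 1) :
    lowerCoeff q d i j = 0 := by
  have : (d : ℤ) - 2 * i - j + 1 = 0 := by omega
  rw [lowerCoeff, this]
  simp

/-- The increment is `q - q⁻¹` times the eigenvalue of `K - K⁻¹` in degree `i + j`: this is the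
commutator relation evaluated at `R ^ j p`. -/
theorem lowerCoeff_succ {q : 𝕜} (hq : q ≠ 0) (d i j : ℕ) :
    lowerCoeff q d i (j + 1) = lowerCoeff q d i j +
      (q - q⁻¹) * (q ^ ((d : ℤ) - 2 * (i + j : ℕ)) - q⁻¹ ^ ((d : ℤ) - 2 * (i + j : ℕ))) := by
  have h1 : q ^ (d : ℤ) ≠ 0 := zpow_ne_zero _ hq
  have h2 : q ^ (i : ℤ) ≠ 0 := zpow_ne_zero _ hq
  have h3 : q ^ (j : ℤ) ≠ 0 := zpow_ne_zero _ hq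
  simp only [lowerCoeff, Nat.cast_add, Nat.cast_one, inv_zpow, zpow_add₀ hq, zpow_sub₀ hq,
    zpow_neg, zpow_one, two_mul]
  field_simp
  ring

/-- The double lowering operator of a raising map `R`, relative to a map `K` and its inverse. -/
structure IsLowering (d : ℕ) (U : ℕ → Submodule 𝕜 V) (R : Module.End 𝕜 V) (q : 𝕜)
    (K K' ψ : Module.End 𝕜 V) : Prop where
  commutator : ψ * R - R * ψ = (q - q⁻¹) • (K - K')
  apply_primitive : ∀ i, 2 * i ≤ d → ∀ p ∈ primitivePart d U R i, ψ p = 0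

variable {q : 𝕜} {K K' ψ : Module.End 𝕜 V}

/-- Moving `ψ` past one `R` at a time adds the increments of `lowerCoeff`, starting from `ψ p = 0`.
-/
theorem IsLowering.apply_pow_succ (h : IsLefschetz d U R) (hq : q ≠ 0)
    (hK : ActsAsPow d U q K) (hK' : ActsAsPow d U q⁻¹ K') (hψ : IsLowering d U R q K K' ψ)
    {i : ℕ} (hi : 2 * i ≤ d) {p : V} (hp : p ∈ primitivePart d U R i) (j : ℕ) :
    ψ ((R ^ (j + 1)) p) = lowerCoeff q d i (j + 1) • (R ^ j) p := by
  have key : ∀ j, ψ ((R ^ (j + 1)) p) = R (ψ ((R ^ j) p)) + ((q - q⁻¹) *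
      (q ^ ((d : ℤ) - 2 * (i + j : ℕ)) - q⁻¹ ^ ((d : ℤ) - 2 * (i + j : ℕ)))) • (R ^ j) p := by
    intro j
    have h1 := LinearMap.congr_fun hψ.commutator ((R ^ j) p)
    have h2 := h.pow_mem j hp.1
    simp only [LinearMap.sub_apply, Module.End.mul_apply, LinearMap.smul_apply, hK _ _ h2,
      hK' _ _ h2, ← sub_smul, smul_smul] at h1
    rw [pow_succ', Module.End.mul_apply, ← h1]
    abel
  induction j with
  | zero =>
    rw [key 0, pow_zero, Module.End.one_apply, hψ.apply_primitive i hi p hp, map_zero, zero_add,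
      lowerCoeff_succ hq, lowerCoeff_zero, zero_add]
  | succ j ih =>
    rw [key (j + 1), ih, map_smul, ← Module.End.mul_apply, ← pow_succ', ← add_smul,
      ← lowerCoeff_succ hq]

theorem IsLefschetz.existsUnique_isLowering (h : IsLefschetz d U R) (hq : q ≠ 0)
    (hK : ActsAsPow d U q K) (hK' : ActsAsPow d U q⁻¹ K') :
    ∃! ψ : Module.End 𝕜 V, IsLowering d U R q K K' ψ := by
  refine existsUnique_of_exists_of_unique ?_ fun ψ₁ ψ₂ h₁ h₂ => ?_
  -- At `j = 0` the truncated exponent `j - 1` is harmless because the coefficient is zero.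
  · obtain ⟨φ, hφ⟩ := h.exists_apply_pow fun i j => lowerCoeff q d i j • R ^ (j - 1)
    have hzero : ∀ i, 2 * i ≤ d → ∀ p ∈ primitivePart d U R i, φ p = 0 := by
      intro i hi p hp
      have := hφ i 0 (by omega) p hp
      simpa [lowerCoeff_zero] using this
    have hsucc : ∀ i j, 2 * i + j ≤ d → ∀ p ∈ primitivePart d U R i,
        φ ((R ^ (j + 1)) p) = lowerCoeff q d i (j + 1) • (R ^ j) p := by
      intro i j hij p hp
      by_cases hj : 2 * i + (j + 1) ≤ d
      · exact hφ i (j + 1) hj p hp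
      · rw [IsLefschetz.pow_eq_zero hp (by omega), lowerCoeff_eq_zero q (by omega), map_zero,
          zero_smul]
    refine ⟨φ, ?_, hzero⟩
    have htop := h.eq_top (N := LinearMap.eqLocus (φ * R - R * φ) ((q - q⁻¹) • (K - K'))) ?_
    · exact LinearMap.ext fun x => (htop ▸ Submodule.mem_top : x ∈ LinearMap.eqLocus _ _)
    · intro i hi p hp j hj
      have h2 := h.pow_mem j hp.1
      have h3 : R (φ ((R ^ j) p)) = lowerCoeff q d i j • (R ^ j) p := by
        rcases j with _ | j
        · simp [hzero i hi p hp, lowerCoeff_zero]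
        · rw [hsucc i j (by omega) p hp, map_smul, ← Module.End.mul_apply, ← pow_succ']
      rw [LinearMap.mem_eqLocus]
      simp only [LinearMap.sub_apply, Module.End.mul_apply, LinearMap.smul_apply, hK _ _ h2,
        hK' _ _ h2, h3]
      rw [← Module.End.mul_apply R, ← pow_succ', hsucc i j (by omega) p hp, lowerCoeff_succ hq]
      module
  · have htop := h.eq_top (N := LinearMap.eqLocus ψ₁ ψ₂) ?_
    · exact LinearMap.ext fun x => (htop ▸ Submodule.mem_top : x ∈ LinearMap.eqLocus _ _)
    · intro i hi p hp j hj
      rw [LinearMap.mem_eqLocus]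
      rcases j with _ | j
      · simp [h₁.apply_primitive i hi p hp, h₂.apply_primitive i hi p hp]
      · rw [h₁.apply_pow_succ h hq hK hK' hi hp, h₂.apply_pow_succ h hq hK hK' hi hp]

/-- On strings `ψ` lowers the degree by one, which multiplies the eigenvalue of `K` by `q ^ 2`. -/
theorem IsLowering.mul_eq_smul_mul (h : IsLefschetz d U R) (hq : q ≠ 0)
    (hK : ActsAsPow d U q K) (hK' : ActsAsPow d U q⁻¹ K') (hψ : IsLowering d U R q K K' ψ) :
    K * ψ = q ^ 2 • (ψ * K) := by
  have htop := h.eq_top (N := LinearMap.eqLocus (K * ψ) (q ^ 2 • (ψ * K))) ?_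
  · exact LinearMap.ext fun x => (htop ▸ Submodule.mem_top : x ∈ LinearMap.eqLocus _ _)
  · intro i hi p hp j hj
    rw [LinearMap.mem_eqLocus]
    simp only [Module.End.mul_apply, LinearMap.smul_apply, hK _ _ (h.pow_mem j hp.1)]
    rcases j with _ | j
    · simp [hψ.apply_primitive i hi p hp]
    · rw [map_smul, hψ.apply_pow_succ h hq hK hK' hi hp, map_smul, hK _ _ (h.pow_mem j hp.1),
        smul_smul, smul_smul, smul_smul]
      congr 1
      have : (d : ℤ) - 2 * (i + j : ℕ) = 2 + ((d : ℤ) - 2 * (i + (j + 1) : ℕ)) := by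
        push_cast; ring
      rw [this, zpow_add₀ hq]
      norm_cast
      ring

theorem IsLefschetz.mul_eq_smul_mul (h : IsLefschetz d U R) (hq : q ≠ 0)
    (hK : ActsAsPow d U q K) : K * R = (q ^ 2)⁻¹ • (R * K) := by
  have htop : LinearMap.eqLocus (K * R) ((q ^ 2)⁻¹ • (R * K)) = ⊤ := by
    rw [eq_top_iff, ← h.iSup_eq_top]
    refine iSup_le fun n x hx => ?_
    rw [LinearMap.mem_eqLocus]
    simp only [Module.End.mul_apply, LinearMap.smul_apply, hK _ _ hx, hK _ _ (h.raise n x hx),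
      map_smul, smul_smul]
    congr 1
    have : (d : ℤ) - 2 * (n + 1 : ℕ) = -2 + ((d : ℤ) - 2 * n) := by
      push_cast; ring
    rw [this, zpow_add₀ hq, zpow_neg]
    norm_cast
  exact LinearMap.ext fun x => (htop ▸ Submodule.mem_top : x ∈ LinearMap.eqLocus _ _)

end Lefschetz

/-! ### The cubic relation and the symmetry between `a` and `a⁻¹` -/

namespace Lefschetz

variable {𝕜 V : Type*} [Field 𝕜] [AddCommGroup V] [Module 𝕜 V]

/-- The `q`-Racah eigenvalue `a q^{d-2n} + a⁻¹ q^{2n-d}`. -/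
def racahEigenvalue (q a : 𝕜) (d n : ℕ) : 𝕜 :=
  a * q ^ ((d : ℤ) - 2 * n) + a⁻¹ * q ^ (2 * (n : ℤ) - d)

/-- `R` acts on `U n` as `A - θ n`, where `θ n` is the `n`-th `q`-Racah eigenvalue. -/
def IsRaisingPart (d : ℕ) (U : ℕ → Submodule 𝕜 V) (q a : 𝕜) (A R : Module.End 𝕜 V) : Prop :=
  ∀ n, ∀ x ∈ U n, A x = R x + racahEigenvalue q a d n • x

/-- The cubic relation between `A` and the double lowering operator, on the `A`-module generated by
a primitive vector of degree `i`. It is symmetric in `a` and `a⁻¹`. -/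
def CubicRelation (d i : ℕ) (q a : 𝕜) (A ψ : Module.End 𝕜 V) (y : V) : Prop :=
  ψ (A (A y)) = (q ^ 2 + (q ^ 2)⁻¹) • A (ψ (A y)) - A (A (ψ y))
    - (q ^ 2 - (q ^ 2)⁻¹) ^ 2 • ψ y
    + ((2 - (q ^ 2 + (q ^ 2)⁻¹)) *
        (q ^ ((d : ℤ) - 2 * i + 1) + q ^ (-((d : ℤ) - 2 * i + 1)))) • A y
    + ((a + a⁻¹) * (q ^ 3 - q - q⁻¹ + (q ^ 3)⁻¹)) • y

section Coefficients

variable {q : 𝕜} (hq : q ≠ 0) (d i j : ℕ)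
include hq

/-- Compares the coefficients of `R ^ (j + 1) p` in the cubic relation at `R ^ j p`. -/
theorem lowerCoeff_recurrence :
    lowerCoeff q d i j - (q ^ 2 + (q ^ 2)⁻¹) * lowerCoeff q d i (j + 1) + lowerCoeff q d i (j + 2) =
      (2 - (q ^ 2 + (q ^ 2)⁻¹)) * (q ^ ((d : ℤ) - 2 * i + 1) + q ^ (-((d : ℤ) - 2 * i + 1))) := by
  have h1 : q ^ (d : ℤ) ≠ 0 := zpow_ne_zero _ hq
  have h2 : q ^ (i : ℤ) ≠ 0 := zpow_ne_zero _ hq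
  have h3 : q ^ (j : ℤ) ≠ 0 := zpow_ne_zero _ hq
  simp only [lowerCoeff, Nat.cast_add, Nat.cast_one, Nat.cast_ofNat, zpow_add₀ hq, zpow_sub₀ hq,
    zpow_neg, two_mul, zpow_ofNat]
  field_simp
  ring

/-- Consecutive eigenvalues lie on a conic independent of `a`. This settles the lowest term, `R ^ (j
- 1) p`, of the cubic relation at `R ^ j p`. -/
theorem racahEigenvalue_quadratic {a : 𝕜} (ha : a ≠ 0) (n : ℕ) :
    racahEigenvalue q a d n ^ 2
      - (q ^ 2 + (q ^ 2)⁻¹) * racahEigenvalue q a d n * racahEigenvalue q a d (n + 1)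
      + racahEigenvalue q a d (n + 1) ^ 2 = - (q ^ 2 - (q ^ 2)⁻¹) ^ 2 := by
  have h1 : q ^ (d : ℤ) ≠ 0 := zpow_ne_zero _ hq
  have h2 : q ^ (n : ℤ) ≠ 0 := zpow_ne_zero _ hq
  simp only [racahEigenvalue, Nat.cast_add, Nat.cast_one, zpow_add₀ hq, zpow_sub₀ hq,
    zpow_one, two_mul]
  field_simp
  ring

/-- Compares the coefficients of the middle term `R ^ (j + 1) p` in the cubic relation at `R ^ (j +
1) p`. -/
theorem lowerCoeff_mul_racahEigenvalue {a : 𝕜} (ha : a ≠ 0) :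
    lowerCoeff q d i (j + 1) * (racahEigenvalue q a d (i + (j + 1)) + racahEigenvalue q a d (i + j))
      - (q ^ 2 + (q ^ 2)⁻¹) * (lowerCoeff q d i (j + 2) * racahEigenvalue q a d (i + (j + 1)) +
        lowerCoeff q d i (j + 1) * racahEigenvalue q a d (i + (j + 1)))
      + lowerCoeff q d i (j + 2) *
        (racahEigenvalue q a d (i + (j + 2)) + racahEigenvalue q a d (i + (j + 1))) =
      (2 - (q ^ 2 + (q ^ 2)⁻¹)) * (q ^ ((d : ℤ) - 2 * i + 1) + q ^ (-((d : ℤ) - 2 * i + 1))) *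
        racahEigenvalue q a d (i + (j + 1))
      + (a + a⁻¹) * (q ^ 3 - q - q⁻¹ + (q ^ 3)⁻¹) := by
  have h1 : q ^ (d : ℤ) ≠ 0 := zpow_ne_zero _ hq
  have h2 : q ^ (i : ℤ) ≠ 0 := zpow_ne_zero _ hq
  have h3 : q ^ (j : ℤ) ≠ 0 := zpow_ne_zero _ hq
  simp only [lowerCoeff, racahEigenvalue, Nat.cast_add, Nat.cast_one, Nat.cast_ofNat,
    zpow_add₀ hq, zpow_sub₀ hq, zpow_neg, two_mul, zpow_ofNat]
  field_simp
  ring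

/-- The previous identity at `j = -1`, with the terms containing `lowerCoeff q d i 0 = 0` removed.
-/
theorem lowerCoeff_mul_racahEigenvalue_zero {a : 𝕜} (ha : a ≠ 0) :
    - (q ^ 2 + (q ^ 2)⁻¹) * (lowerCoeff q d i 1 * racahEigenvalue q a d i)
      + lowerCoeff q d i 1 * (racahEigenvalue q a d (i + 1) + racahEigenvalue q a d i) =
      (2 - (q ^ 2 + (q ^ 2)⁻¹)) * (q ^ ((d : ℤ) - 2 * i + 1) + q ^ (-((d : ℤ) - 2 * i + 1))) *
        racahEigenvalue q a d i
      + (a + a⁻¹) * (q ^ 3 - q - q⁻¹ + (q ^ 3)⁻¹) := by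
  have h1 : q ^ (d : ℤ) ≠ 0 := zpow_ne_zero _ hq
  have h2 : q ^ (i : ℤ) ≠ 0 := zpow_ne_zero _ hq
  simp only [lowerCoeff, racahEigenvalue, Nat.cast_add, Nat.cast_one,
    zpow_add₀ hq, zpow_sub₀ hq, zpow_neg, zpow_one, two_mul]
  field_simp
  ring

end Coefficients

variable {d : ℕ} {U : ℕ → Submodule 𝕜 V} {q a : 𝕜} {A R K K' ψ : Module.End 𝕜 V}

/-- Since `A` is `R` plus a scalar on each degree, both sides expand in three consecutive vectors of
the string (two when `j = 0`), and the coefficient identities apply. -/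
theorem CubicRelation.of_pow (h : IsLefschetz d U R) (hq : q ≠ 0) (ha : a ≠ 0)
    (hA : IsRaisingPart d U q a A R) (hK : ActsAsPow d U q K) (hK' : ActsAsPow d U q⁻¹ K')
    (hψ : IsLowering d U R q K K' ψ) {i : ℕ} (hi : 2 * i ≤ d) {p : V}
    (hp : p ∈ primitivePart d U R i) (j : ℕ) : CubicRelation d i q a A ψ ((R ^ j) p) := by
  have hAx : ∀ n, A ((R ^ n) p) =
      (R ^ (n + 1)) p + racahEigenvalue q a d (i + n) • (R ^ n) p := by
    intro n
    rw [hA _ _ (h.pow_mem n hp.1), pow_succ' R n, Module.End.mul_apply]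
  have hψ0 : ψ ((R ^ 0) p) = 0 := by
    simpa using hψ.apply_primitive i hi p hp
  have hψx := hψ.apply_pow_succ h hq hK hK' hi hp
  rw [CubicRelation]
  rcases j with _ | j
  · have h1 := lowerCoeff_recurrence hq d i 0
    have h2 := lowerCoeff_mul_racahEigenvalue_zero hq d i ha
    rw [lowerCoeff_zero] at h1
    simp only [zero_add] at h1
    simp only [hAx, hψx, hψ0, map_add, map_smul, map_zero, smul_add, smul_zero, add_zero, zero_add]
    linear_combination (norm := module) h1 • ((R ^ 1) p) + h2 • ((R ^ 0) p)
  · have h1 := lowerCoeff_recurrence hq d i (j + 1)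
    have h2 := lowerCoeff_mul_racahEigenvalue hq d i j ha
    have h3 := racahEigenvalue_quadratic hq d ha (i + j)
    simp only [add_assoc, Nat.reduceAdd] at h1 h2 h3
    simp only [hAx, hψx, map_add, map_smul, smul_add, add_assoc, Nat.reduceAdd]
    linear_combination (norm := module) h1 • ((R ^ (j + 2)) p) + h2 • ((R ^ (j + 1)) p) +
      (lowerCoeff q d i (j + 1) * h3) • ((R ^ j) p)

theorem IsRaisingPart.pow_mem_span (h : IsLefschetz d U R) (hA : IsRaisingPart d U q a A R)
    {i : ℕ} {p : V} (hp : p ∈ primitivePart d U R i) (n : ℕ) :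
    (A ^ n) p ∈ Submodule.span 𝕜 (Set.range fun j => (R ^ j) p) := by
  induction n with
  | zero => exact Submodule.subset_span ⟨0, rfl⟩
  | succ n ih =>
    rw [pow_succ', Module.End.mul_apply]
    suffices H : Submodule.span 𝕜 (Set.range fun j => (R ^ j) p) ≤
        (Submodule.span 𝕜 (Set.range fun j => (R ^ j) p)).comap A from H ih
    rw [Submodule.span_le]
    rintro _ ⟨j, rfl⟩
    simp only [SetLike.mem_coe, Submodule.mem_comap]
    rw [hA _ _ (h.pow_mem j hp.1), ← Module.End.mul_apply, ← pow_succ']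
    exact Submodule.add_mem _ (Submodule.subset_span ⟨j + 1, rfl⟩)
      (Submodule.smul_mem _ _ (Submodule.subset_span ⟨j, rfl⟩))

theorem CubicRelation.of_mem_span {d i : ℕ} {s : Set V}
    (hs : ∀ y ∈ s, CubicRelation d i q a A ψ y) {y : V} (hy : y ∈ Submodule.span 𝕜 s) :
    CubicRelation d i q a A ψ y := by
  induction hy using Submodule.span_induction with
  | mem y hy => exact hs y hy
  | zero => simp [CubicRelation]
  | add x y _ _ hx hy =>
    unfold CubicRelation at *
    simp only [map_add, hx, hy]
    module
  | smul c x _ hx =>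
    unfold CubicRelation at *
    simp only [map_smul, hx]
    module

theorem IsLowering.cubicRelation (h : IsLefschetz d U R) (hq : q ≠ 0) (ha : a ≠ 0)
    (hA : IsRaisingPart d U q a A R) (hK : ActsAsPow d U q K) (hK' : ActsAsPow d U q⁻¹ K')
    (hψ : IsLowering d U R q K K' ψ) {i : ℕ} (hi : 2 * i ≤ d) {p : V}
    (hp : p ∈ primitivePart d U R i) (n : ℕ) : CubicRelation d i q a A ψ ((A ^ n) p) := by
  refine CubicRelation.of_mem_span ?_ (hA.pow_mem_span h hp n)
  rintro _ ⟨j, rfl⟩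
  exact CubicRelation.of_pow h hq ha hA hK hK' hψ hi hp j

/-- The second initial value of the recurrence; it does not involve `a`. -/
theorem IsLowering.apply_apply_primitive (h : IsLefschetz d U R) (hq : q ≠ 0)
    (hA : IsRaisingPart d U q a A R) (hK : ActsAsPow d U q K) (hK' : ActsAsPow d U q⁻¹ K')
    (hψ : IsLowering d U R q K K' ψ) {i : ℕ} (hi : 2 * i ≤ d) {p : V}
    (hp : p ∈ primitivePart d U R i) : ψ (A p) = lowerCoeff q d i 1 • p := by
  have h1 := hψ.apply_pow_succ h hq hK hK' hi hp 0
  rw [zero_add, pow_one, pow_zero, Module.End.one_apply] at h1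
  rw [hA _ _ hp.1, map_add, h1, map_smul, hψ.apply_primitive i hi p hp, smul_zero, add_zero]

/-- `V` is spanned by the vectors `A ^ n p` with `p` primitive. -/
theorem IsLefschetz.eq_top_of_pow (h : IsLefschetz d U R) (hA : IsRaisingPart d U q a A R)
    {N : Submodule 𝕜 V}
    (hN : ∀ i, 2 * i ≤ d → ∀ p ∈ primitivePart d U R i, ∀ n, (A ^ n) p ∈ N) : N = ⊤ := by
  refine h.eq_top fun i hi p hp j _ => ?_
  suffices H : (R ^ j) p ∈ Submodule.span 𝕜 (Set.range fun n => (A ^ n) p) by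
    refine Submodule.span_le.2 ?_ H
    rintro _ ⟨n, rfl⟩
    exact hN i hi p hp n
  induction j with
  | zero => exact Submodule.subset_span ⟨0, rfl⟩
  | succ j ih =>
    have h1 : (R ^ (j + 1)) p = A ((R ^ j) p) - racahEigenvalue q a d (i + j) • (R ^ j) p := by
      rw [hA _ _ (h.pow_mem j hp.1), pow_succ', Module.End.mul_apply, add_sub_cancel_right]
    have h2 : Submodule.span 𝕜 (Set.range fun n => (A ^ n) p) ≤
        (Submodule.span 𝕜 (Set.range fun n => (A ^ n) p)).comap A := by
      rw [Submodule.span_le]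
      rintro _ ⟨n, rfl⟩
      exact Submodule.subset_span ⟨n + 1, by simp only [pow_succ', Module.End.mul_apply]⟩
    rw [h1]
    exact Submodule.sub_mem _ (h2 (ih (by omega))) (Submodule.smul_mem _ _ (ih (by omega)))

/-- The double lowering operator is unchanged when `a` is replaced by `a⁻¹`. -/
theorem IsLowering.eq_of_inv {U₁ U₂ : ℕ → Submodule 𝕜 V}
    {R₁ R₂ K₁ K₁' K₂ K₂' ψ₁ ψ₂ : Module.End 𝕜 V} (hq : q ≠ 0) (ha : a ≠ 0)
    (h₁ : IsLefschetz d U₁ R₁) (hA₁ : IsRaisingPart d U₁ q a A R₁)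
    (hK₁ : ActsAsPow d U₁ q K₁) (hK₁' : ActsAsPow d U₁ q⁻¹ K₁')
    (hψ₁ : IsLowering d U₁ R₁ q K₁ K₁' ψ₁)
    (h₂ : IsLefschetz d U₂ R₂) (hA₂ : IsRaisingPart d U₂ q a⁻¹ A R₂)
    (hK₂ : ActsAsPow d U₂ q K₂) (hK₂' : ActsAsPow d U₂ q⁻¹ K₂')
    (hψ₂ : IsLowering d U₂ R₂ q K₂ K₂' ψ₂)
    (hP : ∀ i, 2 * i ≤ d → primitivePart d U₁ R₁ i = primitivePart d U₂ R₂ i) : ψ₁ = ψ₂ := by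
  have htop := h₁.eq_top_of_pow hA₁ (N := LinearMap.eqLocus ψ₁ ψ₂) ?_
  · exact LinearMap.ext fun x => (htop ▸ Submodule.mem_top : x ∈ LinearMap.eqLocus _ _)
  · intro i hi p hp
    have hp' := hp
    rw [hP i hi] at hp'
    -- The recurrence has order two, so two consecutive values are carried through the induction.
    suffices H : ∀ n, ψ₁ ((A ^ n) p) = ψ₂ ((A ^ n) p) ∧
        ψ₁ ((A ^ (n + 1)) p) = ψ₂ ((A ^ (n + 1)) p) from fun n => (H n).1
    intro n
    induction n with
    | zero =>
      simp only [zero_add, pow_zero, pow_one, Module.End.one_apply]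
      exact ⟨(hψ₁.apply_primitive i hi p hp).trans (hψ₂.apply_primitive i hi p hp').symm,
        (hψ₁.apply_apply_primitive h₁ hq hA₁ hK₁ hK₁' hi hp).trans
          (hψ₂.apply_apply_primitive h₂ hq hA₂ hK₂ hK₂' hi hp').symm⟩
    | succ n ih =>
      refine ⟨ih.2, ?_⟩
      have e1 := hψ₁.cubicRelation h₁ hq ha hA₁ hK₁ hK₁' hi hp n
      have e2 := hψ₂.cubicRelation h₂ hq (inv_ne_zero ha) hA₂ hK₂ hK₂' hi hp' n
      obtain ⟨ih1, ih2⟩ := ih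
      simp only [pow_succ', Module.End.mul_apply] at ih2 ⊢
      rw [CubicRelation] at e1 e2
      rw [e1, e2, ih1, ih2, inv_inv, add_comm a⁻¹ a]

end Lefschetz

/-! ### The split decomposition of a tridiagonal system -/

namespace TDSystem

variable {𝕜 V : Type*} [Field 𝕜] [AddCommGroup V] [Module 𝕜 V] {d : ℕ}

/-- The sum `E_0^*V + ⋯ + E_{n-1}^*V`. -/
def flagStar (Φ : TDSystem 𝕜 V d) (n : ℕ) : Submodule 𝕜 V :=
  ⨆ (j : Fin (d + 1)) (_ : (j : ℕ) < n), LinearMap.range (Φ.Estar j)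

/-- The sum `E_nV + ⋯ + E_dV`. -/
def flag (Φ : TDSystem 𝕜 V d) (n : ℕ) : Submodule 𝕜 V :=
  ⨆ (j : Fin (d + 1)) (_ : n ≤ (j : ℕ)), LinearMap.range (Φ.E j)

/-- The split component `U_n`, indexed by natural numbers; it is zero for `n > d`. -/
def splitPart (Φ : TDSystem 𝕜 V d) (n : ℕ) : Submodule 𝕜 V :=
  Φ.flagStar (n + 1) ⊓ Φ.flag n

variable (Φ : TDSystem 𝕜 V d)

theorem splitComponent_eq (i : Fin (d + 1)) : Φ.splitComponent i = Φ.splitPart i := by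
  simp only [splitComponent, splitPart, flagStar, flag, Nat.lt_succ_iff, Fin.le_def]

theorem flagStar_mono : Monotone Φ.flagStar := fun _ _ h =>
  iSup₂_le fun j hj => le_iSup₂_of_le j (hj.trans_le h) le_rfl

theorem flag_anti : Antitone Φ.flag := fun _ _ h =>
  iSup₂_le fun j hj => le_iSup₂_of_le j (h.trans hj) le_rfl

theorem range_le_flag {n : ℕ} {j : Fin (d + 1)} (h : n ≤ (j : ℕ)) :
    LinearMap.range (Φ.E j) ≤ Φ.flag n :=
  le_iSup₂_of_le j h le_rfl

theorem range_le_flagStar {n : ℕ} {j : Fin (d + 1)} (h : (j : ℕ) < n) :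
    LinearMap.range (Φ.Estar j) ≤ Φ.flagStar n :=
  le_iSup₂_of_le j h le_rfl

theorem flagStar_zero : Φ.flagStar 0 = ⊥ := by
  simp [flagStar]

theorem flag_eq_bot {n : ℕ} (h : d < n) : Φ.flag n = ⊥ := by
  rw [eq_bot_iff]
  exact iSup₂_le fun j hj => absurd j.isLt (by omega)

theorem splitPart_eq_bot {n : ℕ} (h : d < n) : Φ.splitPart n = ⊥ := by
  rw [splitPart, Φ.flag_eq_bot h, inf_bot_eq]

theorem iSup_range : ⨆ j, LinearMap.range (Φ.E j) = ⊤ := by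
  rw [← sSup_range, Φ.primitive.ordering.2]
  exact Φ.isTDPair.diag

theorem range_ne_bot (j : Fin (d + 1)) : LinearMap.range (Φ.E j) ≠ ⊥ := by
  have h : LinearMap.range (Φ.E j) ∈ Set.range fun i => LinearMap.range (Φ.E i) := ⟨j, rfl⟩
  rw [Φ.primitive.ordering.2] at h
  exact h.1

theorem range_star_ne_bot (j : Fin (d + 1)) : LinearMap.range (Φ.Estar j) ≠ ⊥ := by
  have h : LinearMap.range (Φ.Estar j) ∈ Set.range fun i => LinearMap.range (Φ.Estar i) :=
    ⟨j, rfl⟩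
  rw [Φ.primitive_star.ordering.2] at h
  exact h.1

theorem flag_zero : Φ.flag 0 = ⊤ := by
  simpa [flag] using Φ.iSup_range

theorem map_Astar_flag_le (n : ℕ) : (Φ.flag n).map Φ.Astar ≤ Φ.flag (n - 1) := by
  simp only [flag, Submodule.map_iSup]
  exact iSup₂_le fun j hj => (Φ.standard j).trans
    (iSup₂_le fun k hk => Φ.range_le_flag (by omega))

theorem map_A_flagStar_le (n : ℕ) : (Φ.flagStar n).map Φ.A ≤ Φ.flagStar (n + 1) := by
  simp only [flagStar, Submodule.map_iSup]
  exact iSup₂_le fun j hj => (Φ.standard_star j).trans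
    (iSup₂_le fun k hk => Φ.range_le_flagStar (by omega))

section Eigenvalues

variable {Φ} {θ θs : ℕ → 𝕜}
  (hθ : ∀ i : Fin (d + 1), LinearMap.range (Φ.E i) = Φ.A.eigenspace (θ i))
  (hθs : ∀ i : Fin (d + 1), LinearMap.range (Φ.Estar i) = Φ.Astar.eigenspace (θs i))

include hθ in
theorem eigenvalue_injective {i j : ℕ} (hi : i ≤ d) (hj : j ≤ d) (h : θ i = θ j) : i = j := by
  have := Φ.primitive.ordering.1 (a₁ := ⟨i, by omega⟩) (a₂ := ⟨j, by omega⟩)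
    (by simp only [hθ, h])
  simpa using this

include hθ in
theorem iSupIndep_range : iSupIndep fun j => LinearMap.range (Φ.E j) := by
  have h := Φ.A.eigenspaces_iSupIndep.comp (f := fun i : Fin (d + 1) => θ i) fun i j hij =>
    Fin.ext (eigenvalue_injective hθ (by omega) (by omega) hij)
  convert h using 2 with i
  exact hθ i

include hθ in
theorem map_A_sub_flag_le {n : ℕ} {x : V} (hx : x ∈ Φ.flag n) :
    Φ.A x - θ n • x ∈ Φ.flag (n + 1) := by
  suffices H : Φ.flag n ≤ (Φ.flag (n + 1)).comap (Φ.A - θ n • LinearMap.id) from H hx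
  refine iSup₂_le fun j hj v hv => ?_
  have hv' := hv
  rw [hθ, Module.End.mem_eigenspace_iff] at hv'
  simp only [Submodule.mem_comap, LinearMap.sub_apply, LinearMap.smul_apply, LinearMap.id_apply, hv']
  rcases hj.eq_or_lt with rfl | hlt
  · rw [sub_self]
    exact zero_mem _
  · have := Φ.range_le_flag (Nat.succ_le_of_lt hlt) hv
    exact Submodule.sub_mem _ (Submodule.smul_mem _ _ this) (Submodule.smul_mem _ _ this)

include hθs in
theorem map_Astar_sub_flagStar_le {n : ℕ} {x : V} (hx : x ∈ Φ.flagStar (n + 1)) :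
    Φ.Astar x - θs n • x ∈ Φ.flagStar n := by
  suffices H : Φ.flagStar (n + 1) ≤ (Φ.flagStar n).comap (Φ.Astar - θs n • LinearMap.id) from H hx
  refine iSup₂_le fun j hj v hv => ?_
  have hv' := hv
  rw [hθs, Module.End.mem_eigenspace_iff] at hv'
  simp only [Submodule.mem_comap, LinearMap.sub_apply, LinearMap.smul_apply, LinearMap.id_apply, hv']
  rcases (Nat.lt_succ_iff.1 hj).eq_or_lt with rfl | hlt
  · rw [sub_self]
    exact zero_mem _
  · have := Φ.range_le_flagStar hlt hv
    exact Submodule.sub_mem _ (Submodule.smul_mem _ _ this) (Submodule.smul_mem _ _ this)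

include hθ in
theorem flag_ne_top {n : ℕ} (hn : 0 < n) : Φ.flag n ≠ ⊤ := by
  intro h
  have h1 : Disjoint (LinearMap.range (Φ.E 0)) (Φ.flag n) :=
    (iSupIndep_range hθ).disjoint_biSup (x := 0) (y := {j : Fin (d + 1) | n ≤ (j : ℕ)})
      (by simp; omega)
  rw [h, disjoint_top] at h1
  exact Φ.range_ne_bot 0 h1

include hθ hθs

/-- The sum of the intersections `(E_0^*V + ⋯ + E_i^*V) ∩ (E_{i+r}V + ⋯ + E_dV)` is invariant under
`A` and `A^*`. -/
theorem iSup_inf_eq_bot_or_eq_top (r : ℕ) :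
    (⨆ i, Φ.flagStar (i + 1) ⊓ Φ.flag (i + r)) = ⊥ ∨
      (⨆ i, Φ.flagStar (i + 1) ⊓ Φ.flag (i + r)) = ⊤ := by
  set W : Submodule 𝕜 V := ⨆ i, Φ.flagStar (i + 1) ⊓ Φ.flag (i + r) with hW
  have hmem : ∀ i, Φ.flagStar (i + 1) ⊓ Φ.flag (i + r) ≤ W := fun i =>
    le_iSup (fun i => Φ.flagStar (i + 1) ⊓ Φ.flag (i + r)) i
  by_contra! hne
  refine Φ.isTDPair.irreducible ⟨W, ?_, ?_, hne.1, hne.2⟩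
  · rw [Submodule.map_le_iff_le_comap]
    refine iSup_le fun i x hx => ?_
    -- `A - θ_{i+r}` maps the `i`-th summand into the next one; below, `A^* - θ_i^*` maps it into
    -- the previous one.
    have h1 : Φ.A x - θ (i + r) • x ∈ W := by
      refine hmem (i + 1) ⟨Submodule.sub_mem _ ?_ (Submodule.smul_mem _ _ ?_), ?_⟩
      · exact Φ.map_A_flagStar_le _ (Submodule.mem_map_of_mem hx.1)
      · exact Φ.flagStar_mono (Nat.le_succ _) hx.1
      · rw [add_right_comm]
        exact map_A_sub_flag_le hθ hx.2
    have h2 := Submodule.add_mem _ h1 (Submodule.smul_mem _ (θ (i + r)) (hmem i hx))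
    rwa [sub_add_cancel] at h2
  · rw [Submodule.map_le_iff_le_comap]
    refine iSup_le fun i x hx => ?_
    have h0 := map_Astar_sub_flagStar_le hθs hx.1
    have h1 : Φ.Astar x - θs i • x ∈ W := by
      rcases i with _ | i
      · rw [Φ.flagStar_zero, Submodule.mem_bot] at h0
        rw [h0]
        exact zero_mem _
      · refine hmem i ⟨h0, Submodule.sub_mem _ ?_ (Submodule.smul_mem _ _ ?_)⟩
        · refine Φ.flag_anti ?_ (Φ.map_Astar_flag_le _ (Submodule.mem_map_of_mem hx.2))
          omega
        · exact Φ.flag_anti (by omega) hx.2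
    have h2 := Submodule.add_mem _ h1 (Submodule.smul_mem _ (θs i) (hmem i hx))
    rwa [sub_add_cancel] at h2

/-- With shift `r = 1` the invariant sum lies in the proper subspace `Φ.flag 1`, so it is zero. -/
theorem disjoint_flagStar_flag (n : ℕ) : Disjoint (Φ.flagStar n) (Φ.flag n) := by
  rcases n with _ | n
  · rw [Φ.flagStar_zero]
    exact disjoint_bot_left
  · have hle : (⨆ i, Φ.flagStar (i + 1) ⊓ Φ.flag (i + 1)) ≤ Φ.flag 1 :=
      iSup_le fun i => inf_le_right.trans (Φ.flag_anti (by omega))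
    rcases iSup_inf_eq_bot_or_eq_top hθ hθs 1 with h | h
    · rw [disjoint_iff, eq_bot_iff, ← h]
      exact le_iSup (fun i => Φ.flagStar (i + 1) ⊓ Φ.flag (i + 1)) n
    · exact absurd (top_le_iff.1 (h ▸ hle)) (flag_ne_top hθ one_pos)

/-- With shift `r = 0` the invariant sum contains `E_0^*V`, so it is not zero. -/
theorem iSup_splitPart : ⨆ n, Φ.splitPart n = ⊤ := by
  refine (iSup_inf_eq_bot_or_eq_top hθ hθs 0).resolve_left fun h => ?_
  have h1 : LinearMap.range (Φ.Estar 0) ≤ ⨆ i, Φ.flagStar (i + 1) ⊓ Φ.flag (i + 0) := by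
    refine le_trans ?_ (le_iSup _ 0)
    rw [Φ.flag_zero, inf_top_eq]
    exact Φ.range_le_flagStar (by simp)
  rw [h, le_bot_iff] at h1
  exact Φ.range_star_ne_bot 0 h1

theorem iSupIndep_splitPart : iSupIndep Φ.splitPart :=
  Submodule.iSupIndep_of_disjoint_flag Φ.flagStar_mono (fun _ => inf_le_left) fun n =>
    (disjoint_flagStar_flag hθ hθs n).mono_right inf_le_right

theorem isCompl_flagStar_flag (n : ℕ) : IsCompl (Φ.flagStar n) (Φ.flag n) := by
  refine ⟨disjoint_flagStar_flag hθ hθs n, codisjoint_iff_le_sup.2 ?_⟩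
  rw [← iSup_splitPart hθ hθs]
  refine iSup_le fun i => ?_
  rcases lt_or_ge i n with h | h
  · exact inf_le_left.trans ((Φ.flagStar_mono h).trans le_sup_left)
  · exact inf_le_right.trans ((Φ.flag_anti h).trans le_sup_right)

/-- By the modular law, `Φ.flag n` is the direct sum of `U_n` and `Φ.flag (n + 1)`. -/
theorem finrank_splitPart_add_flag [FiniteDimensional 𝕜 V] (n : ℕ) :
    Module.finrank 𝕜 (Φ.splitPart n) + Module.finrank 𝕜 (Φ.flag (n + 1)) =
      Module.finrank 𝕜 (Φ.flag n) := by
  have hle : Φ.flag (n + 1) ≤ Φ.flag n := Φ.flag_anti (Nat.le_succ n)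
  have hc := isCompl_flagStar_flag hθ hθs (n + 1)
  rw [← Submodule.finrank_sup_add_finrank_inf_eq, splitPart, inf_right_comm, hc.inf_eq_bot,
    bot_inf_eq, finrank_bot, add_zero, inf_comm, inf_sup_assoc_of_le _ hle, hc.sup_eq_top,
    inf_top_eq]

theorem finrank_flagStar_add_splitPart [FiniteDimensional 𝕜 V] (n : ℕ) :
    Module.finrank 𝕜 (Φ.flagStar n) + Module.finrank 𝕜 (Φ.splitPart n) =
      Module.finrank 𝕜 (Φ.flagStar (n + 1)) := by
  have hle : Φ.flagStar n ≤ Φ.flagStar (n + 1) := Φ.flagStar_mono (Nat.le_succ n)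
  have hc := isCompl_flagStar_flag hθ hθs n
  rw [← Submodule.finrank_sup_add_finrank_inf_eq, splitPart, inf_left_comm, hc.inf_eq_bot,
    inf_bot_eq, finrank_bot, add_zero, inf_comm, ← sup_inf_assoc_of_le _ hle, hc.sup_eq_top,
    top_inf_eq]

end Eigenvalues

end TDSystem

/-! ### The Lefschetz property in `q`-Racah type -/

namespace TDSystem

open Lefschetz

variable {𝕜 V : Type*} [Field 𝕜] [AddCommGroup V] [Module 𝕜 V] {d : ℕ}

theorem secondInversion_flag (Φ : TDSystem 𝕜 V d) (n : ℕ) :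
    Φ.secondInversion.flag n =
      ⨆ (j : Fin (d + 1)) (_ : (j : ℕ) + n ≤ d), LinearMap.range (Φ.E j) := by
  apply le_antisymm
  · refine iSup₂_le fun j hj => ?_
    refine le_iSup₂_of_le (f := fun (j : Fin (d + 1)) (_ : (j : ℕ) + n ≤ d) =>
      LinearMap.range (Φ.E j)) (Fin.rev j) ?_ le_rfl
    rw [Fin.val_rev]
    omega
  · refine iSup₂_le fun j hj => ?_
    have h := Φ.secondInversion.range_le_flag (n := n) (j := Fin.rev j) (by
      rw [Fin.val_rev]
      omega)
    simpa only [secondInversion, Fin.rev_rev] using h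

/-- The index range from `i` to `d - i` is symmetric under `j ↦ d - j`. -/
theorem secondInversion_lowComponent (Φ : TDSystem 𝕜 V d) (i : Fin (d + 1)) :
    Φ.secondInversion.lowComponent i = Φ.lowComponent i := by
  unfold lowComponent
  congr 1
  refine (Equiv.iSup_congr Fin.revPerm fun j => ?_)
  simp only [secondInversion, Fin.revPerm_apply]
  refine iSup_congr_Prop ?_ fun _ => rfl
  rw [Fin.val_rev]
  omega

theorem IsQRacah.secondInversion {Φ : TDSystem 𝕜 V d} {q a b : 𝕜} (hΦ : Φ.IsQRacah q a b) :
    Φ.secondInversion.IsQRacah q a⁻¹ b where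
  q_ne_zero := hΦ.q_ne_zero
  a_ne_zero := inv_ne_zero hΦ.a_ne_zero
  b_ne_zero := hΦ.b_ne_zero
  q_pow_four_ne_one := hΦ.q_pow_four_ne_one
  eigenvalue := fun i => by
    have h := hΦ.eigenvalue (Fin.rev i)
    have h1 : ((Fin.rev i : Fin (d + 1)) : ℤ) = d - i := by
      rw [Fin.val_rev]
      omega
    rw [h1] at h
    refine h.trans (congrArg _ ?_)
    rw [inv_inv, add_comm]
    congr 3 <;> ring
  eigenvalue_star := hΦ.eigenvalue_star

variable {Φ : TDSystem 𝕜 V d} {q a b : 𝕜} (hΦ : Φ.IsQRacah q a b)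

namespace IsQRacah

include hΦ

theorem range_eq_eigenspace (i : Fin (d + 1)) :
    LinearMap.range (Φ.E i) = Φ.A.eigenspace (racahEigenvalue q a d i) :=
  hΦ.eigenvalue i

theorem range_star_eq_eigenspace (i : Fin (d + 1)) :
    LinearMap.range (Φ.Estar i) = Φ.Astar.eigenspace (racahEigenvalue q b d i) :=
  hΦ.eigenvalue_star i

theorem isCompl_secondInversion_flag {m n : ℕ} (h : m + n = d + 1) :
    IsCompl (Φ.secondInversion.flag m) (Φ.flag n) := by
  have hind := iSupIndep_range hΦ.range_eq_eigenspace
  rw [secondInversion_flag]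
  refine ⟨?_, codisjoint_iff_le_sup.2 ?_⟩
  · refine hind.disjoint_biSup_biSup (s := {j : Fin (d + 1) | (j : ℕ) + m ≤ d})
      (t := {j : Fin (d + 1) | n ≤ (j : ℕ)}) (Set.disjoint_left.2 fun j hj hj' => ?_)
    simp only [Set.mem_ofPred_eq] at hj hj'
    omega
  · rw [← Φ.iSup_range]
    refine iSup_le fun j => ?_
    rcases lt_or_ge (j : ℕ) n with hj | hj
    · exact le_sup_of_le_left (le_iSup₂_of_le (f := fun (j : Fin (d + 1)) (_ : (j : ℕ) + m ≤ d) =>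
        LinearMap.range (Φ.E j)) j (by omega) le_rfl)
    · exact le_sup_of_le_right (Φ.range_le_flag hj)

theorem A_mem_flag {n : ℕ} {x : V} (hx : x ∈ Φ.flag n) : Φ.A x ∈ Φ.flag n := by
  have h := Submodule.add_mem _ (Φ.flag_anti (Nat.le_succ n)
    (map_A_sub_flag_le hΦ.range_eq_eigenspace hx)) (Submodule.smul_mem _ (racahEigenvalue q a d n) hx)
  rwa [sub_add_cancel] at h

/-- Split `x` along the two complementary sums of eigenspaces of `A`. The part of `x` outside the
target is killed by `A - θ_i`, so it lies in `E_iV`, which is in the target since `i ≤ d - m`. -/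
theorem mem_secondInversion_flag_of_sub_mem {i m : ℕ} (him : i + m ≤ d) {x : V}
    (hx : Φ.A x - racahEigenvalue q a d i • x ∈ Φ.secondInversion.flag m) :
    x ∈ Φ.secondInversion.flag m := by
  have hc := hΦ.isCompl_secondInversion_flag (m := m) (n := d + 1 - m) (by omega)
  obtain ⟨l, hl, g, hg, rfl⟩ := Submodule.mem_sup.1
    (hc.sup_eq_top ▸ Submodule.mem_top : x ∈ Φ.secondInversion.flag m ⊔ Φ.flag (d + 1 - m))
  have h1 : Φ.A l ∈ Φ.secondInversion.flag m := hΦ.secondInversion.A_mem_flag hl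
  have h2 := hΦ.A_mem_flag hg
  have h3 : Φ.A g - racahEigenvalue q a d i • g = 0 := by
    refine Submodule.disjoint_def.1 hc.disjoint _ ?_
      (Submodule.sub_mem _ h2 (Submodule.smul_mem _ _ hg))
    have h4 := Submodule.sub_mem _ hx
      (Submodule.sub_mem _ h1 (Submodule.smul_mem _ (racahEigenvalue q a d i) hl))
    rw [map_add] at h4
    convert h4 using 1
    module
  have h5 : g ∈ LinearMap.range (Φ.E ⟨i, by omega⟩) := by
    rw [hΦ.range_eq_eigenspace, Module.End.mem_eigenspace_iff]
    exact sub_eq_zero.1 h3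
  refine Submodule.add_mem _ hl ?_
  rw [secondInversion_flag]
  exact le_iSup₂_of_le (f := fun (j : Fin (d + 1)) (_ : (j : ℕ) + m ≤ d) =>
    LinearMap.range (Φ.E j)) ⟨i, by omega⟩ him le_rfl h5

theorem splitPart_raise {R : Module.End 𝕜 V}
    (hR : IsRaisingPart d Φ.splitPart q a Φ.A R) {n : ℕ} {x : V} (hx : x ∈ Φ.splitPart n) :
    R x ∈ Φ.splitPart (n + 1) := by
  have h : R x = Φ.A x - racahEigenvalue q a d n • x := by
    rw [hR n x hx, add_sub_cancel_right]
  rw [h]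
  exact ⟨Submodule.sub_mem _ (Φ.map_A_flagStar_le _ (Submodule.mem_map_of_mem hx.1))
    (Submodule.smul_mem _ _ (Φ.flagStar_mono (Nat.le_succ _) hx.1)),
    map_A_sub_flag_le hΦ.range_eq_eigenspace hx.2⟩

/-- On `U_i`, `R ^ k` is the product of `A - θ_n` for `i ≤ n < i + k`. Its zeros have components
only in the eigenspaces with these indices, and `i + k - 1 = d - m`. -/
theorem mem_secondInversion_flag_of_pow_eq_zero {R : Module.End 𝕜 V}
    (hR : IsRaisingPart d Φ.splitPart q a Φ.A R) {k m : ℕ} :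
    ∀ {i : ℕ}, i + k + m = d + 1 → ∀ {x : V}, x ∈ Φ.splitPart i → (R ^ k) x = 0 →
      x ∈ Φ.secondInversion.flag m := by
  induction k with
  | zero =>
    intro i _ x _ h0
    rw [pow_zero, Module.End.one_apply] at h0
    rw [h0]
    exact zero_mem _
  | succ k ih =>
    intro i hi x hx h0
    refine hΦ.mem_secondInversion_flag_of_sub_mem (i := i) (by omega) ?_
    rw [hR i x hx, add_sub_cancel_right]
    exact ih (i := i + 1) (by omega) (hΦ.splitPart_raise hR hx) h0

/-- `Φ^⇓.flag m` is a complement both of `Φ.flagStar m` and of `Φ.flag (d + 1 - m)`, so these have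
equal dimension; the `U_n` measure the jumps of either flag. -/
theorem finrank_splitPart_sub [FiniteDimensional 𝕜 V] {i : ℕ} (hi : i ≤ d) :
    Module.finrank 𝕜 (Φ.splitPart (d - i)) = Module.finrank 𝕜 (Φ.splitPart i) := by
  have key : ∀ m n, m + n = d + 1 →
      Module.finrank 𝕜 (Φ.flagStar m) = Module.finrank 𝕜 (Φ.flag n) := by
    intro m n h
    have h1 := Submodule.finrank_add_eq_of_isCompl (hΦ.isCompl_secondInversion_flag h)
    have h2 : Module.finrank 𝕜 (Φ.flagStar m) + Module.finrank 𝕜 (Φ.secondInversion.flag m) = _ :=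
      Submodule.finrank_add_eq_of_isCompl (isCompl_flagStar_flag
        hΦ.secondInversion.range_eq_eigenspace hΦ.secondInversion.range_star_eq_eigenspace m)
    omega
  have h1 := finrank_splitPart_add_flag hΦ.range_eq_eigenspace hΦ.range_star_eq_eigenspace i
  have h2 := finrank_flagStar_add_splitPart hΦ.range_eq_eigenspace hΦ.range_star_eq_eigenspace
    (d - i)
  have h3 := key (d - i) (i + 1) (by omega)
  have h4 := key (d - i + 1) i (by omega)
  omega

/-- A kernel vector in `U_i` lies in `Φ^⇓.flag (i + 1)` and in `Φ.flagStar (i + 1)`, which are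
disjoint by the split decomposition of `Φ^⇓`. Surjectivity is then a dimension count. -/
theorem isLefschetz [FiniteDimensional 𝕜 V] {R : Module.End 𝕜 V}
    (hR : IsRaisingPart d Φ.splitPart q a Φ.A R) : IsLefschetz d Φ.splitPart R := by
  have hraise : ∀ k i x, x ∈ Φ.splitPart i → (R ^ k) x ∈ Φ.splitPart (i + k) := by
    intro k
    induction k with
    | zero => exact fun i x hx => hx
    | succ k ih =>
      intro i x hx
      rw [pow_succ', Module.End.mul_apply, ← add_assoc]
      exact hΦ.splitPart_raise hR (ih i x hx)
  have hinj : ∀ i, 2 * i ≤ d → ∀ x ∈ Φ.splitPart i, (R ^ (d - 2 * i)) x = 0 → x = 0 := by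
    intro i hi x hx h0
    exact Submodule.disjoint_def.1 (disjoint_flagStar_flag hΦ.secondInversion.range_eq_eigenspace
      hΦ.secondInversion.range_star_eq_eigenspace (i + 1)) x hx.1
      (hΦ.mem_secondInversion_flag_of_pow_eq_zero hR (by omega) hx h0)
  refine ⟨iSupIndep_splitPart hΦ.range_eq_eigenspace hΦ.range_star_eq_eigenspace,
    iSup_splitPart hΦ.range_eq_eigenspace hΦ.range_star_eq_eigenspace,
    fun _ => Φ.splitPart_eq_bot, fun _ _ => hΦ.splitPart_raise hR, hinj, ?_⟩
  intro i hi y hy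
  have hle : (Φ.splitPart i).map (R ^ (d - 2 * i)) ≤ Φ.splitPart (d - i) := by
    rintro _ ⟨x, hx, rfl⟩
    have := hraise (d - 2 * i) i x hx
    rwa [show i + (d - 2 * i) = d - i by omega] at this
  have hrank : Module.finrank 𝕜 ((Φ.splitPart i).map (R ^ (d - 2 * i))) =
      Module.finrank 𝕜 (Φ.splitPart (d - i)) := by
    rw [hΦ.finrank_splitPart_sub (by omega)]
    refine (LinearEquiv.finrank_eq (LinearEquiv.ofBijective
      ((R ^ (d - 2 * i)).submoduleMap (Φ.splitPart i)) ⟨?_, ?_⟩)).symm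
    · rw [← LinearMap.ker_eq_bot, LinearMap.ker_eq_bot']
      intro x hx
      exact Subtype.ext (hinj i hi x x.2 (congrArg Subtype.val hx))
    · exact LinearMap.submoduleMap_surjective _ _
  rw [← Submodule.eq_of_le_of_finrank_eq hle hrank] at hy
  exact hy

/-- Both sides are the intersection of `U_i` with `Φ^⇓.flag i`. For `p` there, `R ^ (d + 1 - 2 i) p`
stays in this `A`-invariant space and has been raised into its complement `Φ.flag (d + 1 - i)`, so
it is zero. -/
theorem primitivePart_eq [FiniteDimensional 𝕜 V] {R : Module.End 𝕜 V}
    (hR : IsRaisingPart d Φ.splitPart q a Φ.A R) (i : Fin (d + 1)) (hi : 2 * (i : ℕ) ≤ d) :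
    primitivePart d Φ.splitPart R i = Φ.lowComponent i := by
  have hM : (⨆ (j : Fin (d + 1)) (_ : (i : ℕ) ≤ (j : ℕ) ∧ (j : ℕ) + (i : ℕ) ≤ d),
      LinearMap.range (Φ.E j)) = Φ.flag i ⊓ Φ.secondInversion.flag i := by
    set M : Submodule 𝕜 V := ⨆ (j : Fin (d + 1)) (_ : (i : ℕ) ≤ (j : ℕ) ∧ (j : ℕ) + (i : ℕ) ≤ d),
      LinearMap.range (Φ.E j) with hMdef
    have hMle : M ≤ Φ.flag i := iSup₂_le fun j hj => Φ.range_le_flag hj.1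
    apply le_antisymm
    · refine le_inf hMle (iSup₂_le fun j hj => ?_)
      rw [secondInversion_flag]
      exact le_iSup₂_of_le (f := fun (j : Fin (d + 1)) (_ : (j : ℕ) + i ≤ d) =>
        LinearMap.range (Φ.E j)) j hj.2 le_rfl
    · have h1 : Φ.secondInversion.flag i ≤ M ⊔ Φ.secondInversion.flag (d + 1 - i) := by
        rw [secondInversion_flag, secondInversion_flag]
        refine iSup₂_le fun j hj => ?_
        rcases lt_or_ge (j : ℕ) i with hlt | hge
        · exact le_sup_of_le_right (le_iSup₂_of_le
            (f := fun (j : Fin (d + 1)) (_ : (j : ℕ) + (d + 1 - i) ≤ d) =>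
              LinearMap.range (Φ.E j)) j (by omega) le_rfl)
        · exact le_sup_of_le_left (le_iSup₂_of_le
            (f := fun (j : Fin (d + 1)) (_ : (i : ℕ) ≤ (j : ℕ) ∧ (j : ℕ) + (i : ℕ) ≤ d) =>
              LinearMap.range (Φ.E j)) j ⟨hge, hj⟩ le_rfl)
      refine (inf_le_inf_left _ h1).trans ?_
      rw [inf_comm, sup_inf_assoc_of_le _ hMle,
        (hΦ.isCompl_secondInversion_flag (by omega)).inf_eq_bot, sup_bot_eq]
  have hlow : Φ.lowComponent i = Φ.splitPart i ⊓ Φ.secondInversion.flag i := by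
    rw [lowComponent, hM, splitPart, ← inf_assoc]
    simp only [flagStar, Nat.lt_succ_iff, Fin.le_def]
  rw [hlow, primitivePart]
  ext p
  simp only [Submodule.mem_inf, LinearMap.mem_ker, and_congr_right_iff]
  intro hp
  refine ⟨fun h0 => hΦ.mem_secondInversion_flag_of_pow_eq_zero hR (by omega) hp h0, fun hp' => ?_⟩
  have hL := hΦ.isLefschetz hR
  have hmem : ∀ k, (R ^ k) p ∈ Φ.secondInversion.flag i := by
    intro k
    induction k with
    | zero => exact hp'
    | succ k ih =>
      have h1 : R ((R ^ k) p) =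
          Φ.A ((R ^ k) p) - racahEigenvalue q a d (i + k) • (R ^ k) p := by
        rw [hR _ _ (hL.pow_mem k hp), add_sub_cancel_right]
      rw [pow_succ', Module.End.mul_apply, h1]
      exact Submodule.sub_mem _ (hΦ.secondInversion.A_mem_flag ih) (Submodule.smul_mem _ _ ih)
  refine Submodule.disjoint_def.1 (hΦ.isCompl_secondInversion_flag (m := i) (n := d + 1 - i)
    (by omega)).disjoint _ (hmem _) ?_
  have h2 := (hL.pow_mem (d + 1 - 2 * i) hp).2
  rwa [show (i : ℕ) + (d + 1 - 2 * i) = d + 1 - i by omega] at h2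

end IsQRacah

end TDSystem

/-! ### Maps acting by powers of `q` on a grading -/

namespace Lefschetz

variable {𝕜 V : Type*} [Field 𝕜] [AddCommGroup V] [Module 𝕜 V] {d : ℕ} {U : ℕ → Submodule 𝕜 V}

theorem exists_actsAsPow (hind : iSupIndep U) (htop : ⨆ n, U n = ⊤)
    (hbot : ∀ n, d < n → U n = ⊥) (q : 𝕜) : ∃ K : Module.End 𝕜 V, ActsAsPow d U q K := by
  classical
  let f : ∀ i : Fin (d + 1), U i →ₗ[𝕜] V := fun i => (U i).subtype
  have hf : Function.Bijective (LinearMap.lsum 𝕜 (fun i : Fin (d + 1) => U i) 𝕜 f) := by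
    constructor
    · rw [← LinearMap.ker_eq_bot, LinearMap.ker_eq_bot']
      intro v hv
      rw [LinearMap.lsum_apply, LinearMap.sum_apply] at hv
      have h := (iSupIndep_iff_finsetSum_eq_zero_imp_eq_zero fun i : Fin (d + 1) => U i).1
        (hind.comp Fin.val_injective) Finset.univ (fun i => v i) (fun i _ => (v i).2) hv
      exact funext fun i => Subtype.ext (h i (Finset.mem_univ i))
    · rw [← LinearMap.range_eq_top, eq_top_iff, ← htop]
      refine iSup_le fun n x hx => ?_
      rcases lt_or_ge d n with hn | hn
      · rw [hbot n hn, Submodule.mem_bot] at hx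
        rw [hx]
        exact zero_mem _
      · refine ⟨Pi.single (⟨n, by omega⟩ : Fin (d + 1)) ⟨x, hx⟩, ?_⟩
        rw [LinearMap.lsum_piSingle]
        rfl
  obtain ⟨K, hK⟩ := LinearMap.exists_apply_eq_of_bijective_lsum hf
    fun i => q ^ ((d : ℤ) - 2 * (i : ℕ)) • (U i).subtype
  refine ⟨K, fun n x hx => ?_⟩
  rcases lt_or_ge d n with hn | hn
  · rw [hbot n hn, Submodule.mem_bot] at hx
    rw [hx, map_zero, smul_zero]
  · exact hK ⟨n, by omega⟩ ⟨x, hx⟩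

theorem ActsAsPow.eq (htop : ⨆ n, U n = ⊤) {q : 𝕜} {K L : Module.End 𝕜 V}
    (hK : ActsAsPow d U q K) (hL : ActsAsPow d U q L) : K = L := by
  have h : LinearMap.eqLocus K L = ⊤ := by
    rw [eq_top_iff, ← htop]
    exact iSup_le fun n x hx => (hK n x hx).trans (hL n x hx).symm
  exact LinearMap.ext fun x => (h ▸ Submodule.mem_top : x ∈ LinearMap.eqLocus _ _)

theorem ActsAsPow.mul_eq_one (htop : ⨆ n, U n = ⊤) {q : 𝕜} (hq : q ≠ 0) {K L : Module.End 𝕜 V}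
    (hK : ActsAsPow d U q K) (hL : ActsAsPow d U q⁻¹ L) : K * L = 1 := by
  have h : LinearMap.eqLocus (K * L) 1 = ⊤ := by
    rw [eq_top_iff, ← htop]
    refine iSup_le fun n x hx => ?_
    rw [LinearMap.mem_eqLocus, Module.End.mul_apply, hL n x hx, map_smul, hK n x hx, smul_smul,
      inv_zpow, inv_mul_cancel₀ (zpow_ne_zero _ hq), one_smul, Module.End.one_apply]
  exact LinearMap.ext fun x => (h ▸ Submodule.mem_top : x ∈ LinearMap.eqLocus _ _)

theorem ActsAsPow.inv {q : 𝕜} (hq : q ≠ 0) {K : (Module.End 𝕜 V)ˣ}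
    (hK : ActsAsPow d U q (K : Module.End 𝕜 V)) :
    ActsAsPow d U q⁻¹ ((K⁻¹ : (Module.End 𝕜 V)ˣ) : Module.End 𝕜 V) := by
  intro n x hx
  have h := congrArg ((K⁻¹ : (Module.End 𝕜 V)ˣ) : Module.End 𝕜 V) (hK n x hx)
  rw [← Module.End.mul_apply, Units.inv_mul, Module.End.one_apply, map_smul] at h
  conv_rhs => rw [h]
  rw [smul_smul, inv_zpow, inv_mul_cancel₀ (zpow_ne_zero _ hq), one_smul]

end Lefschetz

/-! ### The maps `K`, `B` and `ψ` -/

namespace TDSystem.IsQRacah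

open Lefschetz

variable {𝕜 V : Type*} [Field 𝕜] [AddCommGroup V] [Module 𝕜 V] {d : ℕ}
variable {Φ : TDSystem 𝕜 V d} {q a b : 𝕜} (hΦ : Φ.IsQRacah q a b)

include hΦ

theorem iSup_splitPart_eq_top : ⨆ n, Φ.splitPart n = ⊤ :=
  iSup_splitPart hΦ.range_eq_eigenspace hΦ.range_star_eq_eigenspace

theorem isSplitEigenmap_iff {K : Module.End 𝕜 V} :
    Φ.IsSplitEigenmap q K ↔ ActsAsPow d Φ.splitPart q K := by
  constructor
  · intro hK n x hx
    rcases lt_or_ge d n with hn | hn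
    · rw [Φ.splitPart_eq_bot hn, Submodule.mem_bot] at hx
      rw [hx, map_zero, smul_zero]
    · have h := hK ⟨n, by omega⟩
      rw [splitComponent_eq] at h
      exact Module.End.mem_eigenspace_iff.1 (h ▸ hx)
  · intro hK
    have hinj : Function.Injective fun i : Fin (d + 1) => q ^ ((d : ℤ) - 2 * (i : ℕ)) := by
      intro i j hij
      refine Fin.ext (eigenvalue_injective hΦ.range_eq_eigenspace (by omega) (by omega) ?_)
      -- `θ_n` is a function of `q ^ (d - 2 n)`, so distinctness of the `θ_n` passes to these
      -- powers.
      have h : ∀ n : ℕ, racahEigenvalue q a d n =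
          a * q ^ ((d : ℤ) - 2 * n) + a⁻¹ * (q ^ ((d : ℤ) - 2 * n))⁻¹ := by
        intro n
        rw [racahEigenvalue, ← zpow_neg, neg_sub]
      simp only at hij
      rw [h, h, hij]
    have htop : ⨆ i, Φ.splitComponent i = ⊤ := by
      rw [eq_top_iff, ← hΦ.iSup_splitPart_eq_top]
      refine iSup_le fun n => ?_
      rcases lt_or_ge d n with hn | hn
      · rw [Φ.splitPart_eq_bot hn]
        exact bot_le
      · refine le_iSup_of_le (⟨n, by omega⟩ : Fin (d + 1)) ?_
        rw [splitComponent_eq]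
    -- Independent eigenspaces that contain subspaces spanning `V` must equal them.
    have h := ((K.eigenspaces_iSupIndep.comp hinj).le_iff_eq_of_iSup_eq_top htop).1 fun i x hx => by
      exact Module.End.mem_eigenspace_iff.2 (hK i x (Φ.splitComponent_eq i ▸ hx))
    exact fun i => (congrFun h i).symm

theorem existsUnique_isSplitEigenmap : ∃! K : Module.End 𝕜 V, Φ.IsSplitEigenmap q K := by
  simp only [hΦ.isSplitEigenmap_iff]
  obtain ⟨K, hK⟩ := exists_actsAsPow (iSupIndep_splitPart hΦ.range_eq_eigenspace
    hΦ.range_star_eq_eigenspace) hΦ.iSup_splitPart_eq_top (fun _ => Φ.splitPart_eq_bot) q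
  exact ⟨K, hK, fun L hL => hL.eq hΦ.iSup_splitPart_eq_top hK⟩

theorem isUnit_of_isSplitEigenmap {K : Module.End 𝕜 V} (hK : Φ.IsSplitEigenmap q K) :
    IsUnit K := by
  rw [hΦ.isSplitEigenmap_iff] at hK
  obtain ⟨L, hL⟩ := exists_actsAsPow (iSupIndep_splitPart hΦ.range_eq_eigenspace
    hΦ.range_star_eq_eigenspace) hΦ.iSup_splitPart_eq_top (fun _ => Φ.splitPart_eq_bot) q⁻¹
  refine ⟨⟨K, L, hK.mul_eq_one hΦ.iSup_splitPart_eq_top hΦ.q_ne_zero hL,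
    hL.mul_eq_one hΦ.iSup_splitPart_eq_top (inv_ne_zero hΦ.q_ne_zero) ?_⟩, rfl⟩
  rwa [inv_inv]

theorem isRaisingPart_raisingMap {K : (Module.End 𝕜 V)ˣ}
    (hK : Φ.IsSplitEigenmap q (K : Module.End 𝕜 V)) :
    IsRaisingPart d Φ.splitPart q a Φ.A (Φ.raisingMap a K) := by
  rw [hΦ.isSplitEigenmap_iff] at hK
  intro n x hx
  simp only [raisingMap, LinearMap.sub_apply, LinearMap.smul_apply, hK n x hx,
    hK.inv hΦ.q_ne_zero n x hx]
  have h : q⁻¹ ^ ((d : ℤ) - 2 * n) = q ^ (2 * (n : ℤ) - d) := by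
    rw [inv_zpow, ← zpow_neg, neg_sub]
  rw [h, racahEigenvalue]
  module

theorem isDoubleLowering_iff [FiniteDimensional 𝕜 V] {K : (Module.End 𝕜 V)ˣ}
    (hK : Φ.IsSplitEigenmap q (K : Module.End 𝕜 V)) {ψ : Module.End 𝕜 V} :
    Φ.IsDoubleLowering q a K ψ ↔ IsLowering d Φ.splitPart (Φ.raisingMap a K) q (K : Module.End 𝕜 V)
      ((K⁻¹ : (Module.End 𝕜 V)ˣ) : Module.End 𝕜 V) ψ := by
  have hP := hΦ.primitivePart_eq (hΦ.isRaisingPart_raisingMap hK)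
  constructor
  · rintro ⟨h1, h2⟩
    refine ⟨h1, fun i hi p hp => ?_⟩
    have h := hP ⟨i, by omega⟩ hi
    simp only at h
    rw [h] at hp
    exact h2 _ hi p hp
  · rintro ⟨h1, h2⟩
    refine ⟨h1, fun i hi p hp => h2 i hi p ?_⟩
    rwa [hP i hi]

theorem existsUnique_isDoubleLowering [FiniteDimensional 𝕜 V] {K : (Module.End 𝕜 V)ˣ}
    (hK : Φ.IsSplitEigenmap q (K : Module.End 𝕜 V)) :
    ∃! ψ : Module.End 𝕜 V, Φ.IsDoubleLowering q a K ψ := by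
  simp only [hΦ.isDoubleLowering_iff hK]
  have hK' := hΦ.isSplitEigenmap_iff.1 hK
  exact (hΦ.isLefschetz (hΦ.isRaisingPart_raisingMap hK)).existsUnique_isLowering hΦ.q_ne_zero hK'
    (hK'.inv hΦ.q_ne_zero)

/-- The double lowering operators of `Φ` and `Φ^⇓` coincide. -/
theorem isDoubleLowering_secondInversion [FiniteDimensional 𝕜 V] {K B : (Module.End 𝕜 V)ˣ}
    (hK : Φ.IsSplitEigenmap q (K : Module.End 𝕜 V))
    (hB : Φ.secondInversion.IsSplitEigenmap q (B : Module.End 𝕜 V)) {ψ : Module.End 𝕜 V}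
    (hψ : Φ.IsDoubleLowering q a K ψ) : Φ.secondInversion.IsDoubleLowering q a⁻¹ B ψ := by
  have hΦ' := hΦ.secondInversion
  obtain ⟨ψ', hψ', -⟩ := hΦ'.existsUnique_isDoubleLowering hB
  have hR := hΦ.isRaisingPart_raisingMap hK
  have hR' := hΦ'.isRaisingPart_raisingMap hB
  have hK₁ := hΦ.isSplitEigenmap_iff.1 hK
  have hB₁ := hΦ'.isSplitEigenmap_iff.1 hB
  have h := ((hΦ.isDoubleLowering_iff hK).1 hψ).eq_of_inv hΦ.q_ne_zero hΦ.a_ne_zero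
    (hΦ.isLefschetz hR) hR hK₁ (hK₁.inv hΦ.q_ne_zero) (hΦ'.isLefschetz hR') hR' hB₁
    (hB₁.inv hΦ.q_ne_zero) ((hΦ'.isDoubleLowering_iff hB).1 hψ') fun i hi => by
      have h1 := hΦ.primitivePart_eq hR ⟨i, by omega⟩ hi
      have h2 := hΦ'.primitivePart_eq hR' ⟨i, by omega⟩ hi
      rw [secondInversion_lowComponent] at h2
      exact h1.trans h2.symm
  rwa [h]

end TDSystem.IsQRacah

/-! ### The `U_q(sl_2)`-module structure -/

/-- Endomorphisms that satisfy the relations of `U_q(sl_2)` give a module structure. -/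
theorem Uqsl2.exists_module {𝕜 V : Type*} [Field 𝕜] [AddCommGroup V] [Module 𝕜 V] {q : 𝕜}
    {e f : Module.End 𝕜 V} {k : (Module.End 𝕜 V)ˣ}
    (hke : (k : Module.End 𝕜 V) * e = q ^ 2 • (e * k))
    (hkf : (k : Module.End 𝕜 V) * f = (q ^ 2)⁻¹ • (f * k))
    (hef : e * f - f * e = (q - q⁻¹)⁻¹ •
      ((k : Module.End 𝕜 V) - ((k⁻¹ : (Module.End 𝕜 V)ˣ) : Module.End 𝕜 V))) :
    ∃ _ : Module (Uqsl2 𝕜 q) V, IsScalarTower 𝕜 (Uqsl2 𝕜 q) V ∧ ∀ v : V,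
      Uqsl2.gen q ChevalleyGen.e • v = e v ∧ Uqsl2.gen q ChevalleyGen.f • v = f v ∧
      Uqsl2.gen q ChevalleyGen.k • v = (k : Module.End 𝕜 V) v ∧
      Uqsl2.gen q ChevalleyGen.kinv • v =
        ((k⁻¹ : (Module.End 𝕜 V)ˣ) : Module.End 𝕜 V) v := by
  let g : ChevalleyGen → Module.End 𝕜 V := fun x => match x with
    | .e => e
    | .f => f
    | .k => k
    | .kinv => ((k⁻¹ : (Module.End 𝕜 V)ˣ) : Module.End 𝕜 V)
  have hg : ∀ ⦃x y⦄, UqRel 𝕜 q x y → FreeAlgebra.lift 𝕜 g x = FreeAlgebra.lift 𝕜 g y := by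
    intro x y hxy
    cases hxy <;>
      simp only [map_mul, map_sub, map_smul, map_one, FreeAlgebra.lift_ι_apply, g, hke, hkf, hef,
        smul_mul_assoc, Units.mul_inv, Units.inv_mul, Units.mul_inv_cancel_right]
  let φ : Uqsl2 𝕜 q →ₐ[𝕜] Module.End 𝕜 V :=
    RingQuot.liftAlgHom 𝕜 ⟨FreeAlgebra.lift 𝕜 g, hg⟩
  have hφ : ∀ x, φ (Uqsl2.gen q x) = g x := by
    intro x
    simp only [φ, Uqsl2.gen, RingQuot.liftAlgHom_mkAlgHom_apply, FreeAlgebra.lift_ι_apply]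
  refine ⟨Module.compHom V φ.toRingHom, ?_, fun v => ?_⟩
  · let _ : Module (Uqsl2 𝕜 q) V := Module.compHom V φ.toRingHom
    refine ⟨fun r x v => ?_⟩
    change φ (r • x) v = r • φ x v
    rw [map_smul, LinearMap.smul_apply]
  · exact ⟨LinearMap.congr_fun (hφ .e) v, LinearMap.congr_fun (hφ .f) v,
      LinearMap.congr_fun (hφ .k) v, LinearMap.congr_fun (hφ .kinv) v⟩

theorem lemma8p1 {𝕜 V : Type*} [Field 𝕜] [IsAlgClosed 𝕜] [AddCommGroup V] [Module 𝕜 V]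
    [FiniteDimensional 𝕜 V] [Nontrivial V] {d : ℕ} (hd : 1 ≤ d)
    (Φ : TDSystem 𝕜 V d) (q a b : 𝕜) (hΦ : Φ.IsQRacah q a b) :
    -- the maps `K` and `B` are well defined and invertible
    (∃! K : Module.End 𝕜 V, Φ.IsSplitEigenmap q K) ∧
    (∃! B : Module.End 𝕜 V, Φ.secondInversion.IsSplitEigenmap q B) ∧
    (∀ K : Module.End 𝕜 V, Φ.IsSplitEigenmap q K → IsUnit K) ∧
    (∀ B : Module.End 𝕜 V, Φ.secondInversion.IsSplitEigenmap q B → IsUnit B) ∧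
    ∀ K B : (Module.End 𝕜 V)ˣ, Φ.IsSplitEigenmap q K → Φ.secondInversion.IsSplitEigenmap q B →
      -- the map `ψ` is well defined
      (∃! ψ : Module.End 𝕜 V, Φ.IsDoubleLowering q a K ψ) ∧
      -- the module structure
      ∀ ψ : Module.End 𝕜 V, Φ.IsDoubleLowering q a K ψ →
        ∃ _ : Module (Uqsl2 𝕜 q) V, IsScalarTower 𝕜 (Uqsl2 𝕜 q) V ∧
          ∀ v : V,
            Uqsl2.gen q ChevalleyGen.e • v = (q - q⁻¹)⁻¹ • ψ v ∧
            Uqsl2.gen q ChevalleyGen.f • v =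
              (q - q⁻¹)⁻¹ • Φ.secondInversion.raisingMap a⁻¹ B v ∧
            Uqsl2.gen q ChevalleyGen.k • v = (B : Module.End 𝕜 V) v ∧
            Uqsl2.gen q ChevalleyGen.kinv • v =
              ((B⁻¹ : (Module.End 𝕜 V)ˣ) : Module.End 𝕜 V) v := by
  have hΦ' := hΦ.secondInversion
  refine ⟨hΦ.existsUnique_isSplitEigenmap, hΦ'.existsUnique_isSplitEigenmap,
    fun K => hΦ.isUnit_of_isSplitEigenmap, fun B => hΦ'.isUnit_of_isSplitEigenmap,
    fun K B hK hB => ⟨hΦ.existsUnique_isDoubleLowering hK, fun ψ hψ => ?_⟩⟩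
  have hψ' := (hΦ'.isDoubleLowering_iff hB).1 (hΦ.isDoubleLowering_secondInversion hK hB hψ)
  have hB' := hΦ'.isSplitEigenmap_iff.1 hB
  have hL := hΦ'.isLefschetz (hΦ'.isRaisingPart_raisingMap hB)
  -- Otherwise `q ^ 2 = 1`, and `q ^ 4 - 1 = (q ^ 2 + 1) (q ^ 2 - 1)` would vanish.
  have hne : q - q⁻¹ ≠ 0 := by
    intro h
    have h2 : q * q = 1 := by
      nth_rewrite 2 [sub_eq_zero.1 h]
      exact mul_inv_cancel₀ hΦ.q_ne_zero
    exact hΦ.q_pow_four_ne_one (by linear_combination (q * q + 1) * h2)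
  refine Uqsl2.exists_module (e := (q - q⁻¹)⁻¹ • ψ)
    (f := (q - q⁻¹)⁻¹ • Φ.secondInversion.raisingMap a⁻¹ B) ?_ ?_ ?_
  · rw [mul_smul_comm, hψ'.mul_eq_smul_mul hL hΦ.q_ne_zero hB' (hB'.inv hΦ.q_ne_zero),
      smul_mul_assoc, smul_comm]
  · rw [mul_smul_comm, hL.mul_eq_smul_mul hΦ.q_ne_zero hB', smul_mul_assoc, smul_comm]
  · rw [smul_mul_smul_comm, smul_mul_smul_comm, ← smul_sub, hψ'.commutator, smul_smul,
      mul_assoc, inv_mul_cancel₀ hne, mul_one]
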